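/- Let $K$ be a field. Let $\mathcal B$ be the additive $K$-category whose indecomposable objects are the points $(x,y)\in\mathbb R^2$, with $\mathrm{Hom}((x,y),(x',y'))=K$ if $x\le x'$ and $y\le y'$ and $0$ otherwise, composition being multiplication of scalars (the morphism $1\in K$ is called basic). Let $\mathcal D_\pi$ be the full subcategory of the quotient of $\mathcal B$ by the morphisms factoring through sums of objects with $|y-x|\ge\pi$, on the objects with $|y-x|<\pi$. Let $\mathcal D_\pi^{(2)}$ be obtained by adding to each $(x,y)$ an isomorphic copy $(x,y)'$, let $F$ be the automorphism $F(x,y)=(y+\pi,x+\pi)'$, $F((x,y)')=(y+\pi,x+\pi)$, taking basic morphisms to basic morphisms, and let $\mathcal C=\mathcal C_\pi$ be the continuous cluster category: the orbit category $\mathcal D^{(2)}_\pi/F$, with $\mathrm{Hom}(X,Y)=\bigoplus_{n\in\mathbb Z}\mathrm{Hom}(X,F^nY)$, whose objects are the finite direct sums of the indecomposable objects $M(x,y)$ (image of $(x,y)$) and $M(x,y)'\cong M(x,y)$. Indecomposable objects $X,Y$ of $\mathcal C$ are compatible if $\mathrm{Hom}(X,Y)=0$ or $\mathrm{Hom}(Y,X)=0$.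 A cluster is a maximal pairwise compatible set of pairwise nonisomorphic indecomposable objects that is discrete for the distance induced by the $1$-norm on $\mathbb R^2$. A mutation of a cluster replaces one object $X$ by an indecomposable object $X^*\not\cong X$ such that the result is again a cluster. Let $\mathcal T$ be the standard cluster, which consists of the objects $M\left(\frac{m\pi}{2^n},\pi+\frac{(m-1)\pi}{2^n}\right)$, $n\ge0$, $0\le m<2^{n+1}$, $(n,m)\neq(0,1)$. An indecomposable object is rational if it is isomorphic to an object of a cluster obtained from $\mathcal T$ by finitely many mutations. Let $\mathrm{add}\,\mathcal T$ and $\mathcal X$ be the full subcategories of objects of $\mathcal C$ isomorphic to finite (possibly empty) direct sums of objects of $\mathcal T$, respectively of rational objects. Let $\mathcal C/\mathcal T$ and $\mathcal X/\mathcal T$ be the quotients by the morphisms that factor through an object of $\mathrm{add}\,\mathcal T$; an object of $\mathcal C/\mathcal T$ is said to lie in $\mathcal X/\mathcal T$ if it is isomorphic in $\mathcal C/\mathcal T$ to an object of $\mathcal X$. For $S=M(x,y)\in\mathcal T$ put $S_\epsilon=M(x+\epsilon,y+\epsilon)$ and $$\mathrm{Hom}_{\mathcal C/\mathcal T}(\tau^{-1}S,X)=\lim_{\epsilon\to0+}\mathrm{Hom}_{\mathcal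 C/\mathcal T}(S_\epsilon,X),$$ the direct limit along composition with the basic morphisms $S_{\epsilon'}\to S_{\epsilon}$, $0<\epsilon'\le\epsilon$. The support of an indecomposable object $X$ of $\mathcal C$ is the set of all $S\in\mathcal T$ with $S\not\cong X$ and $\mathrm{Hom}_{\mathcal C/\mathcal T}(\tau^{-1}S,X)\neq0$; the support of an object of $\mathcal C$ is the union of the supports of its indecomposable components. The support of an object $Z$ of $\mathcal C/\mathcal T$ is the set of all $S\in\mathcal T$ with $\mathrm{Hom}_{\mathcal C/\mathcal T}(\tau^{-1}S,Z)\neq0$. Then: 1. An object of $\mathcal C$ lies in $\mathrm{add}\,\mathcal T$ if and only if its support is empty. 2. The support of an object of $\mathcal C$ is finite if and only if the object lies in $\mathcal X$. 3. The support of objects of $\mathcal C/\mathcal T$ is well defined: for each object $X$ of $\mathcal C$, its support as an object of $\mathcal C/\mathcal T$ equals its support as an object of $\mathcal C$, and objects that are isomorphic in $\mathcal C/\mathcal T$ have the same support. 4. An object of $\mathcal C/\mathcal T$ is zero if and only if its support is empty. 5. An object of $\mathcal C/\mathcal T$ lies in $\mathcal X/\mathcal T$ if and only if its support is finite. -/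

import Mathlib

open CategoryTheory

noncomputable section

namespace ContinuousCluster

universe u v w

/-! ### Quotients of additive categories by the ideal of a class of objects -/

section IdealQuotient

variable {C : Type u} [Category.{v} C] [Preadditive C]

/-- Finite sums of morphisms `X ⟶ Y` that factor through an object satisfying `P`. -/
def factorIdeal (P : ObjectProperty C) (X Y : C) : AddSubgroup (X ⟶ Y) :=
  AddSubgroup.closure {f | ∃ (Z : C) (_ : P Z) (g : X ⟶ Z) (h : Z ⟶ Y), f = g ≫ h}

/-- Two morphisms are identified when their difference lies in the ideal of `P`. -/
def idealRel (P : ObjectProperty C) : HomRel C :=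
  fun X Y f g => f - g ∈ factorIdeal P X Y

theorem factorIdeal_precomp (P : ObjectProperty C) {X Y Z : C} (a : X ⟶ Y) {f : Y ⟶ Z}
    (hf : f ∈ factorIdeal P Y Z) : a ≫ f ∈ factorIdeal P X Z := by
  induction hf using AddSubgroup.closure_induction with
  | mem f hf =>
    obtain ⟨W, hW, g, h, rfl⟩ := hf
    exact AddSubgroup.subset_closure ⟨W, hW, a ≫ g, h, by simp⟩
  | zero => simp
  | add f g _ _ hf hg => simpa using add_mem hf hg
  | neg f _ hf => simpa using neg_mem hf

theorem factorIdeal_postcomp (P : ObjectProperty C) {X Y Z : C} {f : X ⟶ Y} (a : Y ⟶ Z)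
    (hf : f ∈ factorIdeal P X Y) : f ≫ a ∈ factorIdeal P X Z := by
  induction hf using AddSubgroup.closure_induction with
  | mem f hf =>
    obtain ⟨W, hW, g, h, rfl⟩ := hf
    exact AddSubgroup.subset_closure ⟨W, hW, g, h ≫ a, by simp⟩
  | zero => simp
  | add f g _ _ hf hg => simpa using add_mem hf hg
  | neg f _ hf => simpa using neg_mem hf

theorem factorIdeal_smul (P : ObjectProperty C) {K : Type w} [Semiring K] [Linear K C]
    (r : K) {X Y : C} {f : X ⟶ Y}
    (hf : f ∈ factorIdeal P X Y) : r • f ∈ factorIdeal P X Y := by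
  have := factorIdeal_postcomp P (r • 𝟙 Y) hf
  simpa using this

instance (P : ObjectProperty C) : Congruence (idealRel P) where
  equivalence :=
    { refl := fun f => by simp [idealRel]
      symm := fun {f g} h => by
        have := neg_mem h
        simpa [idealRel] using this
      trans := fun {f g k} h h' => by
        have := add_mem h h'
        simpa [idealRel] using this }
  comp_left f g g' h := by
    have := factorIdeal_precomp P f h
    simpa [idealRel] using this
  comp_right g h := by
    have := factorIdeal_postcomp P g h
    simpa [idealRel] using this

theorem idealRel_add (P : ObjectProperty C) ⦃X Y : C⦄ (f₁ f₂ g₁ g₂ : X ⟶ Y)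
    (h : idealRel P f₁ f₂) (h' : idealRel P g₁ g₂) : idealRel P (f₁ + g₁) (f₂ + g₂) := by
  have := add_mem h h'
  simpa [idealRel, add_sub_add_comm] using this

theorem idealRel_smul (P : ObjectProperty C) {K : Type w} [Ring K] [Linear K C] (r : K)
    ⦃X Y : C⦄ (f₁ f₂ : X ⟶ Y) (h : idealRel P f₁ f₂) : idealRel P (r • f₁) (r • f₂) := by
  have h1 : r • (f₁ - f₂) ∈ factorIdeal P X Y := factorIdeal_smul P r h
  rw [smul_sub] at h1
  exact h1

instance (P : ObjectProperty C) : Preadditive (Quotient (idealRel P)) :=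
  Quotient.preadditive _ (idealRel_add P)

instance (P : ObjectProperty C) : (Quotient.functor (idealRel P)).Additive :=
  Quotient.functor_additive _ (idealRel_add P)

instance (P : ObjectProperty C) {K : Type w} [Ring K] [Linear K C] :
    Linear K (Quotient (idealRel P)) :=
  Quotient.linear K _ (idealRel_smul P)

instance (P : ObjectProperty C) {K : Type w} [Ring K] [Linear K C] :
    (Quotient.functor (idealRel P)).Linear K :=
  Quotient.linear_functor K _ (idealRel_smul P)

theorem factorIdeal_map {P : ObjectProperty C} (F : C ⥤ C) [F.Additive]
    (hF : ∀ Z, P Z → P (F.obj Z)) {X Y : C} {f : X ⟶ Y} (hf : f ∈ factorIdeal P X Y) :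
    F.map f ∈ factorIdeal P (F.obj X) (F.obj Y) := by
  induction hf using AddSubgroup.closure_induction with
  | mem f hf =>
    obtain ⟨W, hW, g, h, rfl⟩ := hf
    exact AddSubgroup.subset_closure ⟨_, hF _ hW, F.map g, F.map h, by simp⟩
  | zero => simp
  | add f g _ _ hf hg => simpa using add_mem hf hg
  | neg f _ hf => simpa using neg_mem hf

end IdealQuotient

/-! ### Orbit categories -/

section Orbit

/-- The orbit category `C/F` of a category with a shift by `ℤ`, i.e. with compatible powers
`F ^ n = (-)⟦n⟧` of an automorphism `F`: same objects as `C`, morphisms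
`⨁ n, Hom_C(X, F ^ n Y)`. -/
@[ext]
structure OrbitCat (C : Type u) where
  /-- the underlying object -/
  obj : C

variable {C : Type u} [Category.{v} C] [Preadditive C] [HasShift C ℤ]

theorem of_comp_congr {X Y Z : C} {m n k k' : ℤ} (f : ShiftedHom X Y m) (g : ShiftedHom Y Z n)
    (h : n + m = k) (h' : n + m = k') :
    DirectSum.of (fun k => ShiftedHom X Z k) k (f.comp g h) =
      DirectSum.of (fun k => ShiftedHom X Z k) k' (f.comp g h') := by
  subst h; subst h'; rfl

variable [∀ n : ℤ, (shiftFunctor C n).Additive]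

/-- Composition of homogeneous morphisms `X ⟶ F ^ m Y` and `Y ⟶ F ^ n Z`, as a biadditive map. -/
def homogComp (X Y Z : C) (m n : ℤ) :
    ShiftedHom X Y m →+ ShiftedHom Y Z n →+ DirectSum ℤ (fun k => ShiftedHom X Z k) :=
  AddMonoidHom.mk' (fun f => AddMonoidHom.mk'
      (fun g => DirectSum.of (fun k => ShiftedHom X Z k) (n + m) (f.comp g rfl))
      (fun g g' => by simp))
    (fun f f' => by ext g; simp)

/-- Composition in the orbit category, as a biadditive map. -/
def orbitComp (X Y Z : C) :
    DirectSum ℤ (fun k => ShiftedHom X Y k) →+ DirectSum ℤ (fun k => ShiftedHom Y Z k) →+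
      DirectSum ℤ (fun k => ShiftedHom X Z k) :=
  DirectSum.toAddMonoid fun m =>
    (DirectSum.toAddMonoid fun n => (homogComp X Y Z m n).flip).flip

theorem orbitComp_of (X Y Z : C) (m n : ℤ) (f : ShiftedHom X Y m) (g : ShiftedHom Y Z n) :
    orbitComp X Y Z (DirectSum.of (fun k => ShiftedHom X Y k) m f)
      (DirectSum.of (fun k => ShiftedHom Y Z k) n g) =
      DirectSum.of (fun k => ShiftedHom X Z k) (n + m) (f.comp g rfl) := by
  simp [orbitComp, homogComp]

instance : Category.{v} (OrbitCat C) where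
  Hom X Y := DirectSum ℤ (fun n => ShiftedHom X.obj Y.obj n)
  id X := DirectSum.of (fun n => ShiftedHom X.obj X.obj n) 0 (ShiftedHom.mk₀ 0 rfl (𝟙 X.obj))
  comp {X Y Z} f g := orbitComp X.obj Y.obj Z.obj f g
  id_comp {X Y} f := by
    induction f using DirectSum.induction_on with
    | zero => simp
    | add f g hf hg => rw [map_add, hf, hg]
    | of n f =>
      rw [orbitComp_of, of_comp_congr _ _ rfl (add_zero n), ShiftedHom.mk₀_id_comp]
  comp_id {X Y} f := by
    induction f using DirectSum.induction_on with
    | zero => simp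
    | add f g hf hg => rw [map_add, AddMonoidHom.add_apply, hf, hg]
    | of n f =>
      rw [orbitComp_of, of_comp_congr _ _ rfl (zero_add n), ShiftedHom.comp_mk₀_id]
  assoc {W X Y Z} f g h := by
    induction f using DirectSum.induction_on with
    | zero => simp
    | add f f' hf hf' => simp only [map_add, AddMonoidHom.add_apply, hf, hf']
    | of a f =>
      induction g using DirectSum.induction_on with
      | zero => simp
      | add g g' hg hg' => simp only [map_add, AddMonoidHom.add_apply, hg, hg']
      | of b g =>
        induction h using DirectSum.induction_on with
        | zero => simp
        | add h h' hh hh' => simp only [map_add, hh, hh']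
        | of c h =>
          rw [orbitComp_of, orbitComp_of, orbitComp_of, orbitComp_of,
            ShiftedHom.comp_assoc f g h rfl rfl (add_assoc c b a ▸ rfl)]
          exact of_comp_congr _ _ _ _

instance : Preadditive (OrbitCat C) where
  homGroup X Y := inferInstanceAs (AddCommGroup (DirectSum ℤ (fun n => ShiftedHom X.obj Y.obj n)))
  add_comp X Y Z f f' g :=
    DFunLike.congr_fun (AddMonoidHom.map_add (orbitComp X.obj Y.obj Z.obj) f f') g
  comp_add X Y Z f g g' := AddMonoidHom.map_add (orbitComp X.obj Y.obj Z.obj f) g g'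

variable (C) in
/-- The orbit functor `C ⥤ C/F`. -/
def orbitFunctor : C ⥤ OrbitCat C where
  obj X := ⟨X⟩
  map {X Y} f := DirectSum.of (fun n => ShiftedHom X Y n) 0 (ShiftedHom.mk₀ 0 rfl f)
  map_id X := rfl
  map_comp {X Y Z} f g := by
    change _ = orbitComp _ _ _ _ _
    rw [orbitComp_of, ← ShiftedHom.mk₀_comp_mk₀ f g (add_zero 0) rfl rfl]
    rfl

end Orbit

/-! ### The category `B` of pairs of real numbers -/

/-- Points of `ℝ²`. -/
@[ext]
structure Pt where
  /-- first coordinate -/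
  x : ℝ
  /-- second coordinate -/
  y : ℝ

/-- `(x, y) ≤ (x', y')` iff `x ≤ x'` and `y ≤ y'`. -/
instance : PartialOrder Pt where
  le p q := p.x ≤ q.x ∧ p.y ≤ q.y
  le_refl _ := ⟨le_rfl, le_rfl⟩
  le_trans _ _ _ h h' := ⟨h.1.trans h'.1, h.2.trans h'.2⟩
  le_antisymm _ _ h h' := Pt.ext (le_antisymm h.1 h'.1) (le_antisymm h.2 h'.2)

/-- `(x, y) ↦ (y + π, x + π)`, as an order automorphism of `ℝ²`. -/
def rot : Pt ≃o Pt where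
  toFun p := ⟨p.y + Real.pi, p.x + Real.pi⟩
  invFun p := ⟨p.y - Real.pi, p.x - Real.pi⟩
  left_inv p := by simp
  right_inv p := by simp
  map_rel_iff' := by
    intro p q
    change (p.y + Real.pi ≤ q.y + Real.pi ∧ p.x + Real.pi ≤ q.x + Real.pi) ↔
      (p.x ≤ q.x ∧ p.y ≤ q.y)
    simp [and_comm]

theorem abs_rot (p : Pt) : |(rot p).y - (rot p).x| = |p.y - p.x| := by
  change |(p.x + Real.pi) - (p.y + Real.pi)| = _
  rw [add_sub_add_right_eq_sub, abs_sub_comm]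

theorem abs_rot_zpow (n : ℤ) (p : Pt) : |((rot ^ n) p).y - ((rot ^ n) p).x| = |p.y - p.x| := by
  induction n generalizing p with
  | zero => simp
  | succ n ih =>
    rw [zpow_add_one]
    exact (ih (rot p)).trans (abs_rot p)
  | pred n ih =>
    rw [zpow_sub_one]
    refine (ih (rot⁻¹ p)).trans ?_
    rw [← abs_rot (rot⁻¹ p)]
    simp

variable (K : Type u) [Field K]

/-- The full subcategory of `B` on its indecomposable objects `(x, y)`, `x, y ∈ ℝ`:
`Hom((x,y),(x',y'))` is `K` if `x ≤ x'` and `y ≤ y'` and `0` otherwise, and composition is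
multiplication of scalars. It is the `K`-linear category freely generated by the poset `ℝ²`.
All categories below are described by their indecomposable objects; finite direct sums are
added at the end. -/
abbrev B : Type := Free K Pt

/-- The objects `(x, y)` with `|y - x| ≥ π`, which generate the subcategory `B_π` of `B`. -/
def Bpi : ObjectProperty (B K) :=
  fun X => ∃ p : Pt, Real.pi ≤ |p.y - p.x| ∧ X = (Free.embedding K Pt).obj p

/-- The quotient category `B / B_π`. -/
abbrev BModBpi : Type := Quotient (idealRel (Bpi K))

/-- The canonical functor from the poset `ℝ²` to `B / B_π`. Its values on morphisms are the
basic morphisms. -/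
def ptFunctor : Pt ⥤ BModBpi K :=
  Free.embedding K Pt ⋙ Quotient.functor (idealRel (Bpi K))

/-- The open strip `|y - x| < π`. -/
@[ext]
structure Strip where
  /-- the point -/
  pt : Pt
  lt : |pt.y - pt.x| < Real.pi

/-- The indecomposable objects of the continuous derived category `D_π`: the full subcategory of
`B / B_π` on the `(x, y)` with `|y - x| < π`. -/
abbrev D : Type := InducedCategory (BModBpi K) (fun p : Strip => (ptFunctor K).obj p.pt)

/-- The doubled category: each object `(x, y) = (p, false)` of `D_π` gets an isomorphic copy
`(x, y)' = (p, true)` of opposite parity. -/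
abbrev D2 : Type := InducedCategory (D K) (fun X : Strip × Bool => (X.1 : D K))

variable {K}

/-- The basic morphism `X ⟶ Y` of the doubled category, for `X ≤ Y` in `ℝ²`; if `X` and `Y` have
the same coordinates and opposite parity, this is the isomorphism `η` or its inverse. -/
def basic {X Y : D2 K} (h : X.1.pt ≤ Y.1.pt) : X ⟶ Y :=
  InducedCategory.homMk (InducedCategory.homMk ((ptFunctor K).map (homOfLE h)))

theorem basic_refl (X : D2 K) (h : X.1.pt ≤ X.1.pt) : basic h = 𝟙 X := by
  apply InducedCategory.hom_ext
  apply InducedCategory.hom_ext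
  exact (ptFunctor K).map_id _

theorem basic_comp {X Y Z : D2 K} (h : X.1.pt ≤ Y.1.pt) (h' : Y.1.pt ≤ Z.1.pt) :
    basic h ≫ basic h' = basic (h.trans h') := by
  apply InducedCategory.hom_ext
  apply InducedCategory.hom_ext
  exact ((ptFunctor K).map_comp _ _).symm

theorem free_eq_smul {p q : Pt} (f : (Free.embedding K Pt).obj p ⟶ (Free.embedding K Pt).obj q) :
    f = 0 ∨ ∃ (h : p ≤ q) (c : K), f = c • (Free.embedding K Pt).map (homOfLE h) := by
  let g : (p ⟶ q) →₀ K := f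
  by_cases h : p ≤ q
  · refine Or.inr ⟨h, g (homOfLE h), ?_⟩
    have : g = g (homOfLE h) • Finsupp.single (homOfLE h) (1 : K) := by
      refine Finsupp.ext (fun a => ?_)
      obtain rfl : a = homOfLE h := Subsingleton.elim _ _
      simp
    exact this
  · left
    have : g = 0 := Finsupp.ext (fun a => absurd (leOfHom a) h)
    exact this

theorem eq_smul_basic {X Y : D2 K} (f : X ⟶ Y) :
    f = 0 ∨ ∃ (h : X.1.pt ≤ Y.1.pt) (c : K), f = c • basic h := by
  obtain ⟨g, hg⟩ := (Quotient.functor (idealRel (Bpi K))).map_surjective f.hom.hom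
  rcases free_eq_smul g with h | ⟨h, c, hc⟩
  · left
    apply InducedCategory.hom_ext
    apply InducedCategory.hom_ext
    rw [← hg, h]
    exact Functor.map_zero _ _ _
  · refine Or.inr ⟨h, c, ?_⟩
    apply InducedCategory.hom_ext
    apply InducedCategory.hom_ext
    rw [← hg, hc]
    exact Functor.map_smul _ _ _

/-! ### The automorphism `F` and its powers -/

section FreeMap

variable {C : Type v} {C' : Type v} [Category.{w} C] [Category.{w} C']

variable (K) in
/-- Linear extension of a functor to formal linear combinations of morphisms. -/
def freeMapHom (F : C ⥤ C') (X Y : C) :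
    ((Free.embedding K C).obj X ⟶ (Free.embedding K C).obj Y) →ₗ[K]
      ((Free.embedding K C').obj (F.obj X) ⟶ (Free.embedding K C').obj (F.obj Y)) :=
  Finsupp.lmapDomain K K (fun a : X ⟶ Y => F.map a)

theorem freeMapHom_single (F : C ⥤ C') {X Y : C} (a : X ⟶ Y) (r : K) :
    freeMapHom K F X Y (Finsupp.single a r) = Finsupp.single (F.map a) r :=
  Finsupp.mapDomain_single

theorem freeMapHom_comp (F : C ⥤ C') {X Y Z : C}
    (f : (Free.embedding K C).obj X ⟶ (Free.embedding K C).obj Y)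
    (g : (Free.embedding K C).obj Y ⟶ (Free.embedding K C).obj Z) :
    freeMapHom K F X Z (f ≫ g) = freeMapHom K F X Y f ≫ freeMapHom K F Y Z g := by
  induction f using Finsupp.induction_linear with
  | zero =>
    have h1 := map_zero (freeMapHom K F X Y)
    exact (congrArg _ Limits.zero_comp).trans ((map_zero _).trans
      ((congrArg (· ≫ freeMapHom K F Y Z g) h1).trans Limits.zero_comp).symm)
  | add f f' hf hf' =>
    have h1 := map_add (freeMapHom K F X Y) f f'
    refine ((congrArg _ (Preadditive.add_comp _ _ _ _ _ _)).trans (map_add _ _ _)).trans ?_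
    refine (congrArg₂ (· + ·) hf hf').trans ?_
    exact ((congrArg (· ≫ freeMapHom K F Y Z g) h1).trans
        (Preadditive.add_comp _ _ _ _ _ _)).symm
  | single a r =>
    induction g using Finsupp.induction_linear with
    | zero =>
      have h1 := map_zero (freeMapHom K F Y Z)
      exact (congrArg _ Limits.comp_zero).trans ((map_zero _).trans
        ((congrArg (freeMapHom K F X Y _ ≫ ·) h1).trans Limits.comp_zero).symm)
    | add g g' hg hg' =>
      have h1 := map_add (freeMapHom K F Y Z) g g'
      refine ((congrArg _ (Preadditive.comp_add _ _ _ _ _ _)).trans (map_add _ _ _)).trans ?_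
      refine (congrArg₂ (· + ·) hg hg').trans ?_
      exact ((congrArg (freeMapHom K F X Y _ ≫ ·) h1).trans
          (Preadditive.comp_add _ _ _ _ _ _)).symm
    | single b t =>
      refine (congrArg _ (Free.single_comp_single K (C := C) a b r t)).trans ?_
      refine (freeMapHom_single F _ _).trans ?_
      refine Eq.trans ?_ (congrArg₂ (· ≫ ·) (freeMapHom_single F a r)
        (freeMapHom_single F b t)).symm
      refine Eq.trans ?_ (Free.single_comp_single K (C := C') (F.map a) (F.map b) r t).symm
      exact congrArg (fun x => Finsupp.single x (r * t)) (F.map_comp (X := X) (Z := Z) a b)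

variable (K) in
/-- The functor between `K`-linearizations induced by a functor. -/
def freeMap (F : C ⥤ C') : Free K C ⥤ Free K C' where
  obj X := F.obj X
  map f := freeMapHom K F _ _ f
  map_id _ := (freeMapHom_single F _ _).trans
    (congrArg (fun t => Finsupp.single t (1 : K)) (F.map_id _))
  map_comp f g := freeMapHom_comp F f g

instance (F : C ⥤ C') : (freeMap K F).Additive where
  map_add {_ _ f g} := map_add (freeMapHom K F _ _) f g

instance (F : C ⥤ C') : (freeMap K F).Linear K where
  map_smul f r := map_smul (freeMapHom K F _ _) r f

end FreeMap

variable (K) in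
/-- The functor `F ^ n` on `B`, given on objects by the `n`-th power of
`(x, y) ↦ (y + π, x + π)`, sending basic morphisms to basic morphisms. -/
def rotB (n : ℤ) : B K ⥤ B K := freeMap K (rot ^ n).monotone.functor

theorem rotB_Bpi (n : ℤ) (X : B K) (h : Bpi K X) : Bpi K ((rotB K n).obj X) := by
  obtain ⟨p, hp, e⟩ := h
  exact ⟨(rot ^ n) p, by rwa [abs_rot_zpow], congrArg _ e⟩

instance (n : ℤ) : (rotB K n).Additive := inferInstanceAs (freeMap K _).Additive

instance (n : ℤ) : (rotB K n).Linear K := inferInstanceAs ((freeMap K _).Linear K)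

variable (K) in
/-- The functor `F ^ n` on `B / B_π`. -/
def rotQ (n : ℤ) : BModBpi K ⥤ BModBpi K :=
  CategoryTheory.Quotient.lift _ (rotB K n ⋙ Quotient.functor (idealRel (Bpi K))) (by
    intro X Y f g h
    apply CategoryTheory.Quotient.sound
    have := factorIdeal_map (rotB K n) (rotB_Bpi n) h
    rwa [Functor.map_sub] at this)

instance (n : ℤ) : (rotQ K n).Additive where
  map_add {X Y f g} := by
    obtain ⟨f, rfl⟩ := (Quotient.functor (idealRel (Bpi K))).map_surjective f
    obtain ⟨g, rfl⟩ := (Quotient.functor (idealRel (Bpi K))).map_surjective g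
    exact (rotB K n ⋙ Quotient.functor (idealRel (Bpi K))).map_add

instance (n : ℤ) : (rotQ K n).Linear K where
  map_smul {X Y} f r := by
    obtain ⟨f, rfl⟩ := (Quotient.functor (idealRel (Bpi K))).map_surjective f
    exact (rotB K n ⋙ Quotient.functor (idealRel (Bpi K))).map_smul r f

theorem rotQ_map_ptFunctor (n : ℤ) {p q : Pt} (h : p ≤ q) :
    (rotQ K n).map ((ptFunctor K).map (homOfLE h)) =
      (ptFunctor K).map (homOfLE ((rot ^ n).monotone h)) :=
  congrArg (Quotient.functor (idealRel (Bpi K))).map (freeMapHom_single _ _ _)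

/-- `F ^ n` on the objects of the doubled category: `F (x, y) = (y + π, x + π)'` and
`F (x, y)' = (y + π, x + π)`. -/
def rotObj (n : ℤ) (X : Strip × Bool) : Strip × Bool :=
  (⟨(rot ^ n) X.1.pt, by rw [abs_rot_zpow]; exact X.1.lt⟩, (Equiv.boolNot ^ n) X.2)

variable (K) in
/-- The functor `F ^ n` on the doubled category. -/
def rotD2 (n : ℤ) : D2 K ⥤ D2 K where
  obj X := rotObj n X
  map f := InducedCategory.homMk (InducedCategory.homMk ((rotQ K n).map f.hom.hom))
  map_id X := by
    apply InducedCategory.hom_ext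
    apply InducedCategory.hom_ext
    exact (rotQ K n).map_id _
  map_comp f g := by
    apply InducedCategory.hom_ext
    apply InducedCategory.hom_ext
    exact (rotQ K n).map_comp _ _

instance (n : ℤ) : (rotD2 K n).Additive where
  map_add {X Y f g} := by
    apply InducedCategory.hom_ext
    apply InducedCategory.hom_ext
    exact (rotQ K n).map_add

instance (n : ℤ) : (rotD2 K n).Linear K where
  map_smul f r := by
    apply InducedCategory.hom_ext
    apply InducedCategory.hom_ext
    exact (rotQ K n).map_smul r _

theorem rotD2_map_basic (n : ℤ) {X Y : D2 K} (h : X.1.pt ≤ Y.1.pt) :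
    (rotD2 K n).map (basic h) = basic ((rot ^ n).monotone h) := by
  apply InducedCategory.hom_ext
  apply InducedCategory.hom_ext
  exact rotQ_map_ptFunctor n h

theorem eqToHom_eq_basic {X Y : D2 K} (h : X = Y) : eqToHom h = basic (h ▸ le_rfl) := by
  subst h
  exact (basic_refl X _).symm

/-- The natural isomorphism given by basic isomorphisms between two linear functors that agree on
coordinates of objects and on basic morphisms. -/
def basicIso {F G : D2 K ⥤ D2 K} [F.Additive] [F.Linear K] [G.Additive] [G.Linear K]
    (e : ∀ X, (F.obj X).1.pt = (G.obj X).1.pt)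
    (hF : ∀ {X Y : D2 K} (h : X.1.pt ≤ Y.1.pt), ∃ h', F.map (basic h) = basic h')
    (hG : ∀ {X Y : D2 K} (h : X.1.pt ≤ Y.1.pt), ∃ h', G.map (basic h) = basic h') : F ≅ G :=
  NatIso.ofComponents
    (fun X =>
      { hom := basic (e X).le
        inv := basic (e X).ge
        hom_inv_id := by rw [basic_comp, basic_refl]
        inv_hom_id := by rw [basic_comp, basic_refl] })
    (by
      intro X Y f
      rcases eq_smul_basic f with rfl | ⟨h, c, rfl⟩
      · simp
      · obtain ⟨h1, h1'⟩ := hF h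
        obtain ⟨h2, h2'⟩ := hG h
        simp only [Functor.map_smul, Linear.smul_comp, Linear.comp_smul, h1', h2', basic_comp])

theorem rotObj_zero (X : Strip × Bool) : (rotObj 0 X).1.pt = X.1.pt := by
  simp [rotObj]

theorem rotObj_add (m n : ℤ) (X : Strip × Bool) :
    (rotObj (m + n) X).1.pt = (rotObj n (rotObj m X)).1.pt := by
  simp [rotObj, add_comm m n, zpow_add]

variable (K) in
/-- The powers `F ^ n`, `n ∈ ℤ`, form a strict action of `ℤ`; it is encoded as a shift. -/
def rotShift : ShiftMkCore (D2 K) ℤ where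
  F n := rotD2 K n
  zero := basicIso rotObj_zero (fun h => ⟨_, rotD2_map_basic 0 h⟩) (fun h => ⟨h, rfl⟩)
  add m n := basicIso (rotObj_add m n) (fun h => ⟨_, rotD2_map_basic (m + n) h⟩)
    (fun h => ⟨_, (congrArg (rotD2 K n).map (rotD2_map_basic m h)).trans
      (rotD2_map_basic n _)⟩)
  assoc_hom_app m₁ m₂ m₃ X := by
    rw [eqToHom_eq_basic]
    refine (congrArg (basic _ ≫ ·) (rotD2_map_basic m₃ (rotObj_add m₁ m₂ X).le)).trans ?_
    refine (basic_comp _ _).trans ?_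
    refine Eq.trans ?_ (congrArg (basic _ ≫ ·) (basic_comp _ _)).symm
    exact (basic_comp _ _).symm
  zero_add_hom_app n X := by
    rw [eqToHom_eq_basic]
    refine Eq.trans ?_ (congrArg (basic _ ≫ ·)
      (rotD2_map_basic n (rotObj_zero X).ge)).symm
    exact (basic_comp _ _).symm
  add_zero_hom_app n X := by
    rw [eqToHom_eq_basic]
    exact (basic_comp _ _).symm

instance : HasShift (D2 K) ℤ := hasShiftMk _ _ (rotShift K)

instance (n : ℤ) : (shiftFunctor (D2 K) n).Additive :=
  inferInstanceAs (rotD2 K n).Additive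

/-! ### The continuous cluster category -/

variable (K)

/-- The full subcategory of `C_π` on its indecomposable objects: the orbit category of the
doubled category by `F`. -/
abbrev Ind : Type := OrbitCat (D2 K)

/-- The indecomposable object `M(x, y)`. -/
def M (p : Strip) : Ind K := (orbitFunctor (D2 K)).obj (p, false)

/-- The continuous cluster category `C_π`: finite formal direct sums of indecomposable objects. -/
abbrev C : Type 1 := Mat_ (Ind K)

/-- Two indecomposable objects are compatible if there are no nonzero morphisms
in at least one direction. -/
def Compatible (X Y : Ind K) : Prop :=
  (∀ f : X ⟶ Y, f = 0) ∨ (∀ g : Y ⟶ X, g = 0)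

/-- The open ball of radius `ε` around `M(x, y)`, or its shift `M(x, y)'`: all objects isomorphic
to some `M(a, b)` with `|x - a| + |y - b| < ε`. -/
def ball (X : Ind K) (ε : ℝ) : Set (Ind K) :=
  {Y | ∃ p : Strip, |X.obj.1.pt.x - p.pt.x| + |X.obj.1.pt.y - p.pt.y| < ε ∧
    Nonempty (Y ≅ M K p)}

/-- A cluster is a discrete maximal pairwise compatible set of nonisomorphic indecomposable
objects. -/
structure IsCluster (T : Set (Ind K)) : Prop where
  maximal : Maximal
    (fun U : Set (Ind K) => U.Pairwise fun X Y => IsEmpty (X ≅ Y) ∧ Compatible K X Y) T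
  discrete : ∀ X ∈ T, ∃ ε > 0, ∀ Y ∈ T, Y ∈ ball K X ε → Y = X

/-- `T'` is a mutation of `T`: it is a cluster obtained by replacing some `X ∈ T` by an
indecomposable object `X'` that is not isomorphic to `X`. -/
def IsMutation (T T' : Set (Ind K)) : Prop :=
  ∃ X ∈ T, ∃ X' : Ind K, IsEmpty (X' ≅ X) ∧ T' = insert X' (T \ {X}) ∧ IsCluster K T'

theorem std_lt (n m : ℕ) : |(Real.pi + ((m : ℝ) - 1) * Real.pi / 2 ^ n) -
    m * Real.pi / 2 ^ n| < Real.pi := by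
  have h : (Real.pi + ((m : ℝ) - 1) * Real.pi / 2 ^ n) - m * Real.pi / 2 ^ n =
      Real.pi - Real.pi / 2 ^ n := by ring
  have h1 : 0 < Real.pi / 2 ^ n := by positivity
  have h2 : Real.pi / 2 ^ n ≤ Real.pi := div_le_self Real.pi_pos.le (one_le_pow₀ one_le_two)
  rw [h, abs_of_nonneg (by linarith)]
  linarith

/-- The point `(mπ / 2 ^ n, π + (m - 1)π / 2 ^ n)` of the strip. -/
def stdPt (n m : ℕ) : Strip :=
  ⟨⟨m * Real.pi / 2 ^ n, Real.pi + ((m : ℝ) - 1) * Real.pi / 2 ^ n⟩, std_lt n m⟩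

/-- The standard cluster: all `M(mπ / 2 ^ n, π + (m - 1)π / 2 ^ n)` with `n ≥ 0` and
`0 ≤ m < 2 ^ (n + 1)`, except that `M(π, π) = M(0, 0)'` (`n = 0`, `m = 1`) is left out. -/
def stdCluster : Set (Ind K) :=
  {S | ∃ n m : ℕ, m < 2 ^ (n + 1) ∧ ¬(n = 0 ∧ m = 1) ∧ S = M K (stdPt n m)}

/-- An indecomposable object is rational if it is isomorphic to an object of a cluster obtained
from the standard cluster by a finite sequence of mutations. -/
def IsRational (X : Ind K) : Prop :=
  ∃ T : Set (Ind K), Relation.ReflTransGen (IsMutation K) (stdCluster K) T ∧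
    ∃ Y ∈ T, Nonempty (X ≅ Y)

/-- The additive subcategory generated by a set of indecomposable objects: everything isomorphic
to a finite (possibly empty) direct sum of objects of the set. -/
def addClosure (U : Set (Ind K)) : ObjectProperty (C K) :=
  fun X => ∃ Y : C K, (∀ i, Y.X i ∈ U) ∧ Nonempty (X ≅ Y)

/-- The subcategory `add T` for the standard cluster `T`. -/
def addT : ObjectProperty (C K) := addClosure K (stdCluster K)

/-- The rational subcategory `X` of `C_π`. -/
def rationalSub : ObjectProperty (C K) := addClosure K {X | IsRational K X}

/-- The continuous cluster-tilted category `C_π/T`: morphisms of `C_π` modulo those which factor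
through an object of `add T`. -/
abbrev CT : Type 1 := Quotient (idealRel (addT K))

/-- The quotient functor `C_π ⥤ C_π/T`. -/
abbrev toCT : C K ⥤ CT K := Quotient.functor (idealRel (addT K))

/-- The objects of `C_π/T` that lie in `X/T`, up to isomorphism. -/
def rationalSubCT : ObjectProperty (CT K) := (rationalSub K).map (toCT K)

/-! ### The infinitesimal translate and supports -/

variable {K}

/-- The functor `ε ↦ S_ε = M(x + ε, y + ε)` for `S = M(x, y)`; for `ε ≤ ε'` the transition
morphism `S_ε ⟶ S_ε'` is the basic one. -/
def perturb (S : Ind K) : Set.Ioi (0 : ℝ) ⥤ Ind K where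
  obj ε := (orbitFunctor (D2 K)).obj
    (⟨⟨S.obj.1.pt.x + ε, S.obj.1.pt.y + ε⟩, by
      rw [add_sub_add_right_eq_sub]; exact S.obj.1.lt⟩, S.obj.2)
  map {ε ε'} h := (orbitFunctor (D2 K)).map
    (basic ⟨add_le_add le_rfl (show (ε : ℝ) ≤ ε' from leOfHom h),
      add_le_add le_rfl (show (ε : ℝ) ≤ ε' from leOfHom h)⟩)
  map_id ε := by rw [basic_refl]; exact (orbitFunctor (D2 K)).map_id _
  map_comp f g := by rw [← Functor.map_comp, basic_comp]

/-- `S_ε` and the transition morphisms in `C_π/T`. -/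
def perturbCT (S : Ind K) : Set.Ioi (0 : ℝ) ⥤ CT K :=
  perturb S ⋙ Mat_.embedding (Ind K) ⋙ toCT K

/-- `Hom_{C/T}(τ⁻¹S, Z) = lim_{ε → 0+} Hom_{C/T}(S_ε, Z)`, the direct limit being taken along
restriction `Hom_{C/T}(S_ε', Z) → Hom_{C/T}(S_ε, Z)` for `ε ≤ ε'`; the index set is reversed, so
that it is directed towards `0`. -/
abbrev tauInvHom (S : Ind K) (Z : CT K) : Type u :=
  AddCommGroup.DirectLimit
    (fun ε : (Set.Ioi (0 : ℝ))ᵒᵈ => (perturbCT S).obj (OrderDual.ofDual ε) ⟶ Z)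
    (fun _ _ h => Preadditive.leftComp Z
      ((perturbCT S).map (homOfLE (OrderDual.ofDual_le_ofDual.mpr h))))

/-- The support of an object of `C_π`: the union of the supports of its components, where the
support of an indecomposable object `X` consists of the objects `S` of the standard cluster, not
isomorphic to `X`, with `Hom_{C/T}(τ⁻¹S, X) ≠ 0`. -/
def support (X : C K) : Set (Ind K) :=
  {S | S ∈ stdCluster K ∧ ∃ i, IsEmpty (S ≅ X.X i) ∧
    Nontrivial (tauInvHom S ((toCT K).obj ((Mat_.embedding (Ind K)).obj (X.X i))))}

/-- The support of an object of `C_π/T`: the objects `S` of the standard cluster with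
`Hom_{C/T}(τ⁻¹S, Z) ≠ 0`. -/
def supportCT (Z : CT K) : Set (Ind K) :=
  {S | S ∈ stdCluster K ∧ Nontrivial (tauInvHom S Z)}

end ContinuousCluster

end

open CategoryTheory

noncomputable section

namespace ContinuousCluster

universe u

/-! ### Triangulations of a cyclically ordered set -/

section Triangulation

variable {L : Type*} [LinearOrder L]

/-! The point (x, y) of the strip is read as the chord of the circle ℝ/2π with endpoints x and y +
π. `rot` exchanges these endpoints, so isomorphism classes of indecomposable objects are exactly the
chords (`iso_iff_chord`). Every Hom space between indecomposables is at most one-dimensional and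
spanned by a basic morphism (`hom_cases`), and nonzero morphisms in both directions between
nonisomorphic objects mean that the chords cross. Hence triangulations, here required to have a
triangle on both sides of every chord, give clusters, flips give mutations, and the standard cluster
is the dyadic triangulation.

The key fact is `nontrivial_tauInvHom_iff_crosses`: for S in the standard cluster, Hom(τ⁻¹S, X) is
nonzero modulo the cluster exactly when the chords of S and X cross. The support of an object
therefore collects the standard chords crossing one of its components. It is empty iff every
component is itself a standard chord, by maximality of the dyadic triangulation.

Finite supports correspond to rational objects (`isRational_iff`). Each mutation removes a single
object, so a reachable cluster lacks only finitely many standard objects, and its members can cross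
only those. Conversely, if a chord crosses finitely many chords of a triangulation, flipping a
suitable one (`exists_isQuad_of_cross`) lowers the number of crossings; by induction the chord
occurs after finitely many flips.

The statements about the quotient follow because Hom(τ⁻¹S, -) is invariant under isomorphism and is
nonzero on a finite direct sum iff it is nonzero on a summand. -/

/-- Strict cyclic betweenness: going upwards (cyclically) from `a`, one meets `b` before `c`. -/
def CycBtw (a b c : L) : Prop := (a < b ∧ b < c) ∨ (b < c ∧ c < a) ∨ (c < a ∧ a < b)

/-- The chord `{w, z}` crosses the chord `{u, v}`, with `w` between `u` and `v`. -/
def ChordCross (u v w z : L) : Prop := CycBtw u w v ∧ CycBtw v z u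

/-- A triangulation without boundary: a maximal noncrossing set of chords, every chord being the
side of a triangle on either side. -/
structure IsTriangulation (R : L → L → Prop) : Prop where
  symm : ∀ u v, R u v → R v u
  ne : ∀ u v, R u v → u ≠ v
  noncrossing : ∀ u v w z, R u v → R w z → ¬ ChordCross u v w z
  maximal : ∀ u v, u ≠ v → (∀ w z, R w z → ¬ ChordCross u v w z) → R u v
  triangle : ∀ u v, R u v → ∃ w, CycBtw u w v ∧ R u w ∧ R w v

/-- Crossing means the cyclic order u, w, v, z; started at w, it reads w, v, z, u. -/
theorem ChordCross.swap {u v w z : L} (h : ChordCross u v w z) : ChordCross w z v u := by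
  unfold ChordCross CycBtw at *
  grind

theorem ChordCross.flip {u v w z : L} (h : ChordCross u v w z) : ChordCross v u z w :=
  ⟨h.2, h.1⟩

/-- Replace the chord `{p, q}` by the chord `{a, r}`. -/
def flipRel (R : L → L → Prop) (p q a r : L) (u v : L) : Prop :=
  (R u v ∧ s(u, v) ≠ s(p, q)) ∨ s(u, v) = s(a, r)

/-- A chord which crosses one diagonal of a quadrilateral but no side is the other diagonal. -/
theorem eq_diagonal {p q a r u v : L} (ha : CycBtw p a q) (hr : CycBtw q r p)
    (h : ChordCross p q u v)
    (h1 : ¬ ChordCross p a u v) (h2 : ¬ ChordCross a q u v)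
    (h3 : ¬ ChordCross q r v u) (h4 : ¬ ChordCross r p v u) : u = a ∧ v = r := by
  -- If u were strictly between p and a, then v, which lies between q and p, would be on the other
  -- side of {p, a}. The other three sides exclude the remaining positions in the same way.
  unfold ChordCross CycBtw at *
  grind

variable {R : L → L → Prop}

theorem CycBtw.rotate {a b c : L} (h : CycBtw a b c) : CycBtw b c a := by
  unfold CycBtw at *
  grind

theorem CycBtw.ne_left {a b c : L} (h : CycBtw a b c) : a ≠ b := by
  unfold CycBtw at *
  grind

/-! ### Flips of quadrilaterals -/

/-- A quadrilateral of a triangulation, with diagonal `{p, q}` in the triangulation. -/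
structure IsQuad (R : L → L → Prop) (p q a r : L) : Prop where
  diag : R p q
  cyc_left : CycBtw p a q
  cyc_right : CycBtw q r p
  pa : R p a
  aq : R a q
  qr : R q r
  rp : R r p

/-- In a triangulation, a chord crossing the diagonal of a quadrilateral and no chord of the
triangulation other than this diagonal is the other diagonal. -/
theorem IsQuad.eq_other (hR : IsTriangulation R) {p q a r u v : L} (h : IsQuad R p q a r)
    (hc : ChordCross p q u v)
    (hn : ∀ w z, R w z → s(w, z) ≠ s(p, q) → ¬ ChordCross u v w z) : u = a ∧ v = r := by
  have key : ∀ w z, R w z → s(w, z) ≠ s(p, q) → ¬ ChordCross w z u v := fun w z hw hne hx =>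
    hn z w (hR.symm _ _ hw) (by rwa [Sym2.eq_swap]) hx.swap.flip.flip
  have key' : ∀ w z, R w z → s(w, z) ≠ s(p, q) → ¬ ChordCross w z v u := fun w z hw hne hx =>
    hn w z hw hne hx.swap.flip
  have e1 := h.cyc_left.ne_left
  have e2 := h.cyc_left.rotate.ne_left
  have e3 := h.cyc_right.ne_left
  have e4 := h.cyc_right.rotate.ne_left
  have e5 := h.cyc_left.rotate.rotate.ne_left
  refine eq_diagonal h.cyc_left h.cyc_right hc (key _ _ h.pa ?_) (key _ _ h.aq ?_)
    (key' _ _ h.qr ?_) (key' _ _ h.rp ?_) <;>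
  · rw [Ne, Sym2.eq_iff]
    grind

/-- A chord of a triangulation which crosses the other diagonal of a quadrilateral is the
diagonal. -/
theorem IsQuad.eq_diag_of_cross (hR : IsTriangulation R) {p q a r u v : L} (h : IsQuad R p q a r)
    (hc : ChordCross a r u v) (huv : R u v) : u = q ∧ v = p := by
  have key : ∀ w z, R w z → ¬ ChordCross w z u v := fun w z hw hx =>
    hR.noncrossing _ _ _ _ hw huv hx
  have key' : ∀ w z, R w z → ¬ ChordCross w z v u := fun w z hw hx =>
    hR.noncrossing _ _ _ _ hw (hR.symm _ _ huv) hx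
  -- The same quadrilateral, read from its other diagonal.
  refine eq_diagonal (p := a) (q := r) (a := q) (r := p) ?_ ?_ hc (key _ _ h.aq) (key _ _ h.qr)
    (key' _ _ h.rp) (key' _ _ h.pa)
  all_goals
    have h1 := h.cyc_left
    have h2 := h.cyc_right
    unfold CycBtw at *
    grind

/-- Two different apexes on the same side of {p, q} would make a side of one triangle cross a side
of the other. -/
theorem triangle_unique (hR : IsTriangulation R) {p q a w : L} (ha : CycBtw p a q)
    (hw : CycBtw p w q) (h1 : R p a) (h2 : R a q) (h3 : R p w) (h4 : R w q) : w = a := by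
  have n1 := hR.noncrossing _ _ _ _ h1 h4
  have n2 := hR.noncrossing _ _ _ _ h2 (hR.symm _ _ h3)
  have n3 := hR.noncrossing _ _ _ _ h3 h2
  have n4 := hR.noncrossing _ _ _ _ h4 (hR.symm _ _ h1)
  unfold ChordCross CycBtw at *
  grind

/-- Only the two triangles at {p, q} are destroyed. By `triangle_unique`, a chord whose triangle
used {p, q} is a side of the quadrilateral, and its new apex is the vertex across the old diagonal.
-/
theorem IsQuad.flip_triangle (hR : IsTriangulation R) {p q a r : L} (h : IsQuad R p q a r)
    {u v : L} (huv : flipRel R p q a r u v) :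
    ∃ w, CycBtw u w v ∧ flipRel R p q a r u w ∧ flipRel R p q a r w v := by
  have c1 := h.cyc_left
  have c2 := h.cyc_right
  have d1 := h.diag
  have d2 := hR.symm _ _ h.diag
  have s1 := h.pa
  have s2 := hR.symm _ _ h.pa
  have s3 := h.aq
  have s4 := hR.symm _ _ h.aq
  have s5 := h.qr
  have s6 := hR.symm _ _ h.qr
  have s7 := h.rp
  have s8 := hR.symm _ _ h.rp
  unfold flipRel at *
  simp only [Ne, Sym2.eq_iff] at *
  rcases huv with ⟨huv, hne⟩ | ⟨rfl, rfl⟩ | ⟨rfl, rfl⟩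
  · obtain ⟨w, hw, hw1, hw2⟩ := hR.triangle _ _ huv
    by_cases e1 : (u = p ∧ w = q) ∨ (u = q ∧ w = p)
    · rcases e1 with ⟨rfl, rfl⟩ | ⟨rfl, rfl⟩
      · obtain rfl : v = r := triangle_unique hR h.cyc_right hw.rotate s5 s7 hw2
          (hR.symm _ _ huv)
        refine ⟨a, ?_⟩
        unfold CycBtw at *
        grind
      · obtain rfl : v = a := triangle_unique hR h.cyc_left hw.rotate s1 s3 hw2
          (hR.symm _ _ huv)
        refine ⟨r, ?_⟩
        unfold CycBtw at *
        grind
    · by_cases e2 : (w = p ∧ v = q) ∨ (w = q ∧ v = p)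
      · rcases e2 with ⟨rfl, rfl⟩ | ⟨rfl, rfl⟩
        · obtain rfl : u = r := triangle_unique hR h.cyc_right hw.rotate.rotate s5 s7
            (hR.symm _ _ huv) hw1
          refine ⟨a, ?_⟩
          unfold CycBtw at *
          grind
        · obtain rfl : u = a := triangle_unique hR h.cyc_left hw.rotate.rotate s1 s3
            (hR.symm _ _ huv) hw1
          refine ⟨r, ?_⟩
          unfold CycBtw at *
          grind
      · exact ⟨w, hw, Or.inl ⟨hw1, e1⟩, Or.inl ⟨hw2, e2⟩⟩
  -- The new diagonal has apex q on one side and p on the other.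
  · refine ⟨q, ?_⟩
    unfold CycBtw at *
    grind
  · refine ⟨p, ?_⟩
    unfold CycBtw at *
    grind

theorem IsQuad.other_cross {p q a r : L} (h : IsQuad R p q a r) : ChordCross p q a r :=
  ⟨h.cyc_left, h.cyc_right⟩

/-- Flipping the diagonal of a quadrilateral gives a triangulation. -/
theorem IsQuad.flip (hR : IsTriangulation R) {p q a r : L} (h : IsQuad R p q a r) :
    IsTriangulation (flipRel R p q a r) where
  symm u v huv := by
    rcases huv with ⟨h1, h2⟩ | h1
    · exact Or.inl ⟨hR.symm _ _ h1, by rwa [Sym2.eq_swap]⟩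
    · exact Or.inr (by rwa [Sym2.eq_swap])
  ne u v huv := by
    rcases huv with ⟨h1, h2⟩ | h1
    · exact hR.ne _ _ h1
    · have := h.other_cross
      rw [Sym2.eq_iff] at h1
      unfold ChordCross CycBtw at this
      grind
  noncrossing u v w z huv hwz hc := by
    -- The only old chord crossing the new diagonal is the one removed.
    have key : ∀ u v w z, s(u, v) = s(a, r) → R w z → s(w, z) ≠ s(p, q) →
        ¬ ChordCross u v w z := by
      clear huv hwz hc u v w z
      intro u v w z huv hwz hne hc
      rcases Sym2.eq_iff.mp huv with ⟨rfl, rfl⟩ | ⟨rfl, rfl⟩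
      · obtain ⟨rfl, rfl⟩ := h.eq_diag_of_cross hR hc hwz
        exact hne Sym2.eq_swap
      · obtain ⟨rfl, rfl⟩ := h.eq_diag_of_cross hR hc.flip (hR.symm _ _ hwz)
        exact hne rfl
    rcases huv with ⟨h1, h2⟩ | h1
    · rcases hwz with ⟨h3, h4⟩ | h3
      · exact hR.noncrossing _ _ _ _ h1 h3 hc
      · exact key w z v u h3 (hR.symm _ _ h1) (by rwa [Sym2.eq_swap]) hc.swap
    · rcases hwz with ⟨h3, h4⟩ | h3
      · exact key u v w z h1 h3 h4 hc
      · rw [Sym2.eq_iff] at h1 h3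
        unfold ChordCross CycBtw at hc
        grind
  maximal u v hne hn := by
    -- A chord crossing {p, q} but nothing else must be the new diagonal; a chord not crossing {p,
    -- q} was already present, and is not {p, q} because {p, q} crosses {a, r}.
    by_cases hc : ChordCross p q u v
    · obtain ⟨rfl, rfl⟩ := h.eq_other hR hc (fun w z h1 h2 => hn w z (Or.inl ⟨h1, h2⟩))
      exact Or.inr rfl
    by_cases hc' : ChordCross p q v u
    · obtain ⟨rfl, rfl⟩ := h.eq_other hR hc'
        (fun w z h1 h2 h3 => hn z w (Or.inl ⟨hR.symm _ _ h1, by rwa [Sym2.eq_swap]⟩) h3.flip)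
      exact Or.inr Sym2.eq_swap
    · refine Or.inl ⟨hR.maximal _ _ hne ?_, ?_⟩
      · intro w z hwz hx
        by_cases he : s(w, z) = s(p, q)
        · rcases Sym2.eq_iff.mp he with ⟨rfl, rfl⟩ | ⟨rfl, rfl⟩
          · exact hc' hx.swap
          · exact hc hx.flip.swap
        · exact hn w z (Or.inl ⟨hwz, he⟩) hx
      · intro he
        rcases Sym2.eq_iff.mp he with ⟨rfl, rfl⟩ | ⟨rfl, rfl⟩
        · exact hn a r (Or.inr rfl) h.other_cross
        · exact hn r a (Or.inr Sym2.eq_swap) h.other_cross.flip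
  triangle u v huv := h.flip_triangle hR huv

theorem exists_isQuad (hR : IsTriangulation R) {p q : L} (h : R p q) :
    ∃ a r, IsQuad R p q a r := by
  obtain ⟨a, ha, h1, h2⟩ := hR.triangle _ _ h
  obtain ⟨r, hr, h3, h4⟩ := hR.triangle _ _ (hR.symm _ _ h)
  exact ⟨a, r, h, ha, hr, h1, h2, h3, h4⟩

/-- If a chord crosses finitely many chords of a triangulation, but at least one, then the
triangle at its first endpoint is part of a quadrilateral whose diagonal it crosses. -/
theorem exists_isQuad_of_cross (hR : IsTriangulation R) {a b : L}
    (hfin : {c : L × L | R c.1 c.2 ∧ ChordCross c.1 c.2 a b}.Finite)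
    (hne : {c : L × L | R c.1 c.2 ∧ ChordCross c.1 c.2 a b}.Nonempty) :
    ∃ p q r, IsQuad R p q a r ∧ ChordCross p q a b := by
  -- Among the chords crossed, take one whose arc around a is minimal for inclusion. If its apex w
  -- were not a, then {p, w} or {w, q} would also be crossed, with an arc that no longer contains w.
  obtain ⟨⟨p, q⟩, ⟨hpq, hc⟩, hmin⟩ :=
    hfin.exists_minimalFor (fun c => {w : L | CycBtw c.1 w c.2}) _ hne
  obtain ⟨w, r, hq⟩ := exists_isQuad hR hpq
  suffices w = a by subst this; exact ⟨p, q, r, hq, hc⟩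
  by_contra hwa
  have c1 := hq.cyc_left
  have hcase : ChordCross p w a b ∨ ChordCross w q a b := by
    simp only at hc
    unfold ChordCross CycBtw at *
    grind
  rcases hcase with h | h
  · have hsub : {x : L | CycBtw p x w} ⊆ {x : L | CycBtw p x q} := by
      intro x (hx : CycBtw p x w)
      change CycBtw p x q
      unfold CycBtw at *
      grind
    have h2 : CycBtw p w w := hmin (j := (p, w)) ⟨hq.pa, h⟩ hsub c1
    unfold CycBtw at h2
    grind
  · have hsub : {x : L | CycBtw w x q} ⊆ {x : L | CycBtw p x q} := by
      intro x (hx : CycBtw w x q)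
      change CycBtw p x q
      unfold CycBtw at *
      grind
    have h2 : CycBtw w w q := hmin (j := (w, q)) ⟨hq.aq, h⟩ hsub c1
    unfold CycBtw at h2
    grind

end Triangulation

/-! ### Points of the strip as chords of the circle -/

theorem rot_zpow_two_mul (k : ℤ) (p : Pt) :
    (rot ^ (2 * k)) p = ⟨p.x + k * (2 * Real.pi), p.y + k * (2 * Real.pi)⟩ := by
  induction k with
  | zero => simp
  | succ n ih =>
    rw [mul_add, mul_one, add_comm, zpow_add, RelIso.mul_apply, ih, zpow_two, RelIso.mul_apply]
    apply Pt.ext <;> simp [rot] <;> ring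
  | pred n ih =>
    have h2 : (rot ^ (-2 : ℤ)) = (rot⁻¹ * rot⁻¹ : Pt ≃o Pt) := by
      rw [zpow_neg, zpow_two, mul_inv_rev]
    rw [show 2 * (-(n : ℤ) - 1) = -2 + 2 * (-(n : ℤ)) by ring, zpow_add, RelIso.mul_apply, ih,
      h2, RelIso.mul_apply]
    change rot.symm (rot.symm _) = _
    apply Pt.ext <;> simp [rot, OrderIso.symm] <;> ring

theorem rot_zpow_two_mul_add_one (k : ℤ) (p : Pt) :
    (rot ^ (2 * k + 1)) p =
      ⟨p.y + Real.pi + k * (2 * Real.pi), p.x + Real.pi + k * (2 * Real.pi)⟩ := by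
  rw [zpow_add_one, RelIso.mul_apply, rot_zpow_two_mul]
  rfl

/-- The circle `ℝ / 2π`, as a half-open interval. -/
abbrev Circ : Type := Set.Ico (0 : ℝ) (2 * Real.pi)

/-- Reduction modulo `2π`. -/
def vmod (r : ℝ) : Circ :=
  ⟨toIcoMod Real.two_pi_pos 0 r, by simpa only [zero_add] using toIcoMod_mem_Ico Real.two_pi_pos 0 r⟩

theorem vmod_spec (r : ℝ) : ∃ k : ℤ, r = vmod r + k * (2 * Real.pi) := by
  refine ⟨toIcoDiv Real.two_pi_pos 0 r, ?_⟩
  have := toIcoMod_add_toIcoDiv_zsmul Real.two_pi_pos 0 r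
  rw [zsmul_eq_mul] at this
  exact this.symm

theorem vmod_add_mul (r : ℝ) (k : ℤ) : vmod (r + k * (2 * Real.pi)) = vmod r := by
  apply Subtype.ext
  change toIcoMod _ _ _ = toIcoMod _ _ _
  rw [← zsmul_eq_mul, toIcoMod_add_zsmul]

theorem vmod_eq_iff {r s : ℝ} : vmod r = vmod s ↔ ∃ k : ℤ, s = r + k * (2 * Real.pi) := by
  constructor
  · intro h
    obtain ⟨k, hk⟩ := vmod_spec r
    obtain ⟨l, hl⟩ := vmod_spec s
    refine ⟨l - k, ?_⟩
    rw [← h] at hl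
    push_cast
    linarith
  · rintro ⟨k, rfl⟩
    exact (vmod_add_mul r k).symm

theorem vmod_coe (v : Circ) : vmod v = v := by
  apply Subtype.ext
  exact (toIcoMod_eq_self Real.two_pi_pos).mpr (by simp)

theorem int_lt_of_mul_pi {k l : ℤ} (h : (k : ℝ) * (2 * Real.pi) < l * (2 * Real.pi)) : k < l := by
  have := lt_of_mul_lt_mul_right h Real.two_pi_pos.le
  exact_mod_cast this

/-- Betweenness on the circle lifts to the line: the arc from a to b is the image of the interval
(a, b), which is shorter than one turn. -/
theorem cycBtw_vmod_iff {a b : ℝ} (c : ℝ) (h : a < b) (h' : b < a + 2 * Real.pi) :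
    CycBtw (vmod a) (vmod c) (vmod b) ↔
      ∃ k : ℤ, a < c + k * (2 * Real.pi) ∧ c + k * (2 * Real.pi) < b := by
  obtain ⟨i, hi⟩ := vmod_spec a
  obtain ⟨j, hj⟩ := vmod_spec b
  obtain ⟨l, hl⟩ := vmod_spec c
  obtain ⟨a1, a2⟩ := (vmod a).2
  obtain ⟨b1, b2⟩ := (vmod b).2
  obtain ⟨c1, c2⟩ := (vmod c).2
  have hji : i ≤ j := by
    have : i < j + 1 := int_lt_of_mul_pi (by push_cast; linarith)
    omega
  have hji' : j ≤ i + 1 := by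
    have : j < i + 1 + 1 := int_lt_of_mul_pi (by push_cast; linarith)
    omega
  unfold CycBtw
  simp only [← Subtype.coe_lt_coe]
  -- The second case is an arc through the base point 0 of the circle.
  have hcases : j = i ∨ j = i + 1 := by omega
  rcases hcases with rfl | rfl
  · have hab : (vmod a : ℝ) < vmod b := by linarith
    constructor
    · intro hc
      refine ⟨j - l, ?_⟩
      push_cast
      rcases hc with hc | hc | hc
      · constructor <;> linarith
      · exfalso; linarith
      · exfalso; linarith
    · rintro ⟨k, hk1, hk2⟩
      have h1 : j < l + k + 1 := int_lt_of_mul_pi (by push_cast; linarith)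
      have h2 : l + k < j + 1 := int_lt_of_mul_pi (by push_cast; linarith)
      obtain rfl : j = l + k := by omega
      push_cast at *
      left
      constructor <;> linarith
  · push_cast at hj
    have hab : (vmod b : ℝ) < vmod a := by linarith
    constructor
    · intro hc
      rcases hc with hc | hc | hc
      · exfalso; linarith
      · refine ⟨i + 1 - l, ?_⟩
        push_cast
        constructor <;> linarith
      · refine ⟨i - l, ?_⟩
        push_cast
        constructor <;> linarith
    · rintro ⟨k, hk1, hk2⟩
      have h1 : i < l + k + 1 := int_lt_of_mul_pi (by push_cast; linarith)
      have h2 : l + k < i + 1 + 1 := int_lt_of_mul_pi (by push_cast; linarith)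
      have hcases : l + k = i ∨ l + k = i + 1 := by omega
      rcases hcases with e | e
      · have e' : (l : ℝ) + k = i := by exact_mod_cast e
        have e'' : (l : ℝ) * (2 * Real.pi) + k * (2 * Real.pi) = i * (2 * Real.pi) := by
          rw [← e']; ring
        right; right
        constructor <;> linarith
      · have e' : (l : ℝ) + k = i + 1 := by exact_mod_cast e
        have e'' : (l : ℝ) * (2 * Real.pi) + k * (2 * Real.pi) = (i + 1) * (2 * Real.pi) := by
          rw [← e']; ring
        right; left
        constructor <;> linarith

/-- The endpoints on the circle of the chord of a point of the strip. -/
def chord (p : Pt) : Sym2 Circ := s(vmod p.x, vmod (p.y + Real.pi))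

/-- `rot` turns the endpoints x, y + π into y + π, x + 2π; this is the purpose of the shift by π in
`chord`. -/
theorem chord_rot (p : Pt) : chord (rot p) = chord p := by
  have h : vmod (p.x + Real.pi + Real.pi) = vmod p.x := by
    have := vmod_add_mul p.x 1
    rwa [show p.x + ((1 : ℤ) : ℝ) * (2 * Real.pi) = p.x + Real.pi + Real.pi by
      push_cast; ring] at this
  change s(vmod (p.y + Real.pi), vmod (p.x + Real.pi + Real.pi)) = _
  rw [h, Sym2.eq_swap]
  rfl

theorem chord_rot_zpow (n : ℤ) (p : Pt) : chord ((rot ^ n) p) = chord p := by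
  induction n generalizing p with
  | zero => simp
  | succ n ih =>
    rw [zpow_add_one, RelIso.mul_apply, ih, chord_rot]
  | pred n ih =>
    rw [zpow_sub_one, RelIso.mul_apply, ih, ← chord_rot (rot⁻¹ p), RelIso.apply_inv_self]

/-- Points of the strip have the same chord iff they are in the same orbit. -/
theorem chord_eq_iff {p q : Pt} (hp : |p.y - p.x| < Real.pi) (hq : |q.y - q.x| < Real.pi) :
    chord p = chord q ↔ ∃ n : ℤ, p = (rot ^ n) q := by
  constructor
  · intro h
    rw [abs_lt] at hp hq
    rcases Sym2.eq_iff.mp h with ⟨h1, h2⟩ | ⟨h1, h2⟩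
    · obtain ⟨k, hk⟩ := vmod_eq_iff.mp h1.symm
      obtain ⟨l, hl⟩ := vmod_eq_iff.mp h2.symm
      -- Both points lie in the strip, so 2π(l - k) is less than 2π in absolute value.
      have e1 : k < l + 1 := int_lt_of_mul_pi (by push_cast; linarith)
      have e2 : l < k + 1 := int_lt_of_mul_pi (by push_cast; linarith)
      obtain rfl : k = l := by omega
      refine ⟨2 * k, ?_⟩
      rw [rot_zpow_two_mul]
      apply Pt.ext <;> dsimp only <;> linarith
    · obtain ⟨k, hk⟩ := vmod_eq_iff.mp h1.symm
      obtain ⟨l, hl⟩ := vmod_eq_iff.mp h2.symm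
      -- With the endpoints exchanged, the strip condition leaves only l = k + 1, an odd power of
      -- `rot`.
      have e1 : k < l := int_lt_of_mul_pi (by linarith)
      have e2 : l < k + 1 + 1 := int_lt_of_mul_pi (by push_cast; linarith)
      obtain rfl : l = k + 1 := by omega
      refine ⟨2 * k + 1, ?_⟩
      rw [rot_zpow_two_mul_add_one]
      push_cast at hl
      apply Pt.ext <;> dsimp only <;> linarith
  · rintro ⟨n, rfl⟩
    exact chord_rot_zpow n q

/-- The chords of two points cross, in terms of representatives. -/
def Crosses (p q : Pt) : Prop :=
  ∃ n : ℤ, p.x < ((rot ^ n) q).x ∧ ((rot ^ n) q).x < p.y + Real.pi ∧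
    p.y < ((rot ^ n) q).y ∧ ((rot ^ n) q).y < p.x + Real.pi

/-- Lift w into (x, y + π) and z into (y + π, x + 2π). The point formed by the first lift and the
second minus π lies in the strip and has the chord of q, hence lies in the orbit of q. -/
theorem crosses_iff {p q : Pt} (hp : |p.y - p.x| < Real.pi) (hq : |q.y - q.x| < Real.pi) :
    Crosses p q ↔ ∃ w z : Circ, chord q = s(w, z) ∧
      ChordCross (vmod p.x) (vmod (p.y + Real.pi)) w z := by
  have hp' := abs_lt.mp hp
  have per : vmod (p.x + 2 * Real.pi) = vmod p.x := by
    have := vmod_add_mul p.x 1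
    rwa [Int.cast_one, one_mul] at this
  constructor
  · rintro ⟨n, h1, h2, h3, h4⟩
    refine ⟨_, _, (chord_rot_zpow n q).symm, ?_, ?_⟩
    · exact (cycBtw_vmod_iff _ (by linarith) (by linarith)).mpr ⟨0, by simpa using ⟨h1, h2⟩⟩
    · rw [← per]
      refine (cycBtw_vmod_iff _ (by linarith) (by linarith)).mpr ⟨0, ?_⟩
      push_cast
      constructor <;> linarith
  · rintro ⟨w, z, hq', h1, h2⟩
    rw [← vmod_coe w, cycBtw_vmod_iff _ (by linarith) (by linarith)] at h1
    rw [← per, ← vmod_coe z, cycBtw_vmod_iff _ (by linarith) (by linarith)] at h2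
    obtain ⟨k, hk1, hk2⟩ := h1
    obtain ⟨l, hl1, hl2⟩ := h2
    set r : Pt := ⟨w + k * (2 * Real.pi), z + l * (2 * Real.pi) - Real.pi⟩ with hr
    have hr' : |r.y - r.x| < Real.pi := by
      rw [abs_lt]
      constructor <;> simp only [hr] <;> linarith
    have : chord r = chord q := by
      rw [hq']
      simp only [chord, hr, sub_add_cancel, vmod_add_mul, vmod_coe]
    obtain ⟨n, hn⟩ := (chord_eq_iff hr' hq).mp this
    refine ⟨n, ?_⟩
    rw [← hn]
    simp only [hr]
    refine ⟨hk1, hk2, ?_, ?_⟩ <;> linarith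

theorem exists_chord_eq {u v : Circ} (h : u ≠ v) : ∃ p : Strip, chord p.pt = s(u, v) := by
  wlog hlt : u < v generalizing u v
  · obtain ⟨p, hp⟩ := this h.symm (lt_of_le_of_ne (not_lt.mp hlt) h.symm)
    exact ⟨p, hp.trans Sym2.eq_swap⟩
  · refine ⟨⟨⟨u, v - Real.pi⟩, ?_⟩, ?_⟩
    · obtain ⟨h1, h2⟩ := u.2
      obtain ⟨h3, h4⟩ := v.2
      rw [← Subtype.coe_lt_coe] at hlt
      rw [abs_lt]
      constructor <;> dsimp only <;> linarith
    · simp [chord, vmod_coe]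

theorem chord_ends_ne {p : Pt} (hp : |p.y - p.x| < Real.pi) :
    vmod p.x ≠ vmod (p.y + Real.pi) := by
  intro h
  rw [abs_lt] at hp
  obtain ⟨k, hk⟩ := vmod_eq_iff.mp h
  have e1 : 0 < k := int_lt_of_mul_pi (by push_cast; linarith)
  have e2 : k < 1 := int_lt_of_mul_pi (by push_cast; linarith)
  omega

/-! ### The dyadic triangulation -/

/-- The dyadic multiple `jπ / 2 ^ n` of `π`. -/
def dyad (n : ℕ) (j : ℤ) : ℝ := j * Real.pi / 2 ^ n

theorem dyad_lt_iff {n : ℕ} {i j : ℤ} : dyad n i < dyad n j ↔ i < j := by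
  unfold dyad
  rw [div_lt_div_iff_of_pos_right (by positivity), mul_lt_mul_iff_left₀ Real.pi_pos, Int.cast_lt]

theorem dyad_add_mul (n : ℕ) (j k : ℤ) :
    dyad n (j + k * 2 ^ (n + 1)) = dyad n j + k * (2 * Real.pi) := by
  unfold dyad
  push_cast
  field_simp
  ring

theorem dyad_mul_two_pow (n d : ℕ) (j : ℤ) : dyad (n + d) (j * 2 ^ d) = dyad n j := by
  unfold dyad
  push_cast
  rw [pow_add]
  field_simp

theorem dyad_succ_two_mul (n : ℕ) (j : ℤ) : dyad (n + 1) (2 * j) = dyad n j := by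
  rw [mul_comm, ← dyad_mul_two_pow n 1 j, pow_one]

theorem dyad_add_one (n : ℕ) (j : ℤ) : dyad n (j + 1) = dyad n j + Real.pi / 2 ^ n := by
  unfold dyad
  push_cast
  ring

theorem vmod_dyad_add_mul (n : ℕ) (j k : ℤ) :
    vmod (dyad n (j + k * 2 ^ (n + 1))) = vmod (dyad n j) := by
  rw [dyad_add_mul, vmod_add_mul]

theorem cycBtw_dyad {n : ℕ} {a b : ℤ} (c : ℤ) (h : a < b) (h' : b < a + 2 ^ (n + 1)) :
    CycBtw (vmod (dyad n a)) (vmod (dyad n c)) (vmod (dyad n b)) ↔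
      ∃ k : ℤ, a < c + k * 2 ^ (n + 1) ∧ c + k * 2 ^ (n + 1) < b := by
  have e : dyad n b < dyad n a + 2 * Real.pi := by
    have := dyad_add_mul n a 1
    rw [Int.cast_one, one_mul, one_mul] at this
    rw [← this]
    exact dyad_lt_iff.mpr h'
  rw [cycBtw_vmod_iff _ (dyad_lt_iff.mpr h) e]
  simp_rw [← dyad_add_mul, dyad_lt_iff]

theorem chordCross_vmod {a b c d : ℝ} (h1 : a < c) (h2 : c < b) (h3 : b < d)
    (h4 : d < a + 2 * Real.pi) : ChordCross (vmod a) (vmod b) (vmod c) (vmod d) := by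
  have per : vmod (a + 2 * Real.pi) = vmod a := by
    have := vmod_add_mul a 1
    rwa [Int.cast_one, one_mul] at this
  refine ⟨(cycBtw_vmod_iff _ (by linarith) (by linarith)).mpr ⟨0, by simpa using ⟨h1, h2⟩⟩, ?_⟩
  rw [← per]
  exact (cycBtw_vmod_iff _ (by linarith) (by linarith)).mpr ⟨0, by simpa using ⟨h3, h4⟩⟩

/-- The chords of the standard cluster. -/
def StdRel (u v : Circ) : Prop :=
  ∃ (n : ℕ) (j : ℤ), s(u, v) = s(vmod (dyad n j), vmod (dyad n (j + 1)))

theorem stdRel_dyad (n : ℕ) (j : ℤ) : StdRel (vmod (dyad n j)) (vmod (dyad n (j + 1))) :=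
  ⟨n, j, rfl⟩

theorem StdRel.symm {u v : Circ} (h : StdRel u v) : StdRel v u := by
  obtain ⟨n, j, h⟩ := h
  exact ⟨n, j, by rw [← h, Sym2.eq_swap]⟩

/-- At the finer level, the coarse chord joins two integers and the fine chord joins consecutive
ones. Consecutive integers cannot lie strictly on opposite sides of an integer. -/
theorem dyad_noncrossing (n d : ℕ) (j i : ℤ) {w z : Circ}
    (h : s(w, z) = s(vmod (dyad (n + d) i), vmod (dyad (n + d) (i + 1)))) :
    ¬ ChordCross (vmod (dyad n j)) (vmod (dyad n (j + 1))) w z := by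
  rintro ⟨h1, h2⟩
  have hN : (0 : ℤ) < 2 ^ d := by positivity
  have hM : (2 : ℤ) ^ d < 2 ^ (n + d + 1) := by
    apply pow_lt_pow_right₀ <;> omega
  have per : vmod (dyad n j) = vmod (dyad (n + d) (j * 2 ^ d + 2 ^ (n + d + 1))) := by
    have := vmod_dyad_add_mul (n + d) (j * 2 ^ d) 1
    rw [one_mul] at this
    rw [this, dyad_mul_two_pow]
  rw [per] at h2
  rw [← dyad_mul_two_pow n d j, ← dyad_mul_two_pow n d (j + 1)] at h1
  rw [← dyad_mul_two_pow n d (j + 1)] at h2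
  have hB : (j + 1) * 2 ^ d = j * 2 ^ d + 2 ^ d := by ring
  rw [hB] at h1 h2
  generalize j * 2 ^ d = A at *
  rcases Sym2.eq_iff.mp h with ⟨rfl, rfl⟩ | ⟨rfl, rfl⟩ <;>
  · rw [cycBtw_dyad _ (by omega) (by omega)] at h1 h2
    obtain ⟨k, hk1, hk2⟩ := h1
    obtain ⟨l, hl1, hl2⟩ := h2
    generalize (2 : ℤ) ^ d = N at *
    generalize (2 : ℤ) ^ (n + d + 1) = M at *
    -- Lying beyond the far end of the coarse arc forces l to exceed k; the full turn this adds
    -- carries the second lift to A + M or further.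
    have hkl : k < l := lt_of_mul_lt_mul_right (a := M) (by omega) (by omega)
    have : (k + 1) * M ≤ l * M := mul_le_mul_of_nonneg_right (by omega) (by omega)
    rw [add_mul, one_mul] at this
    omega

theorem stdRel_noncrossing {u v w z : Circ} (h : StdRel u v) (h' : StdRel w z) :
    ¬ ChordCross u v w z := by
  intro hc
  obtain ⟨n, j, h⟩ := h
  obtain ⟨m, i, h'⟩ := h'
  have key : ∀ {n m : ℕ} {j i : ℤ} {u v w z : Circ},
      s(u, v) = s(vmod (dyad n j), vmod (dyad n (j + 1))) →
      s(w, z) = s(vmod (dyad m i), vmod (dyad m (i + 1))) → n ≤ m → ¬ ChordCross u v w z := by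
    intro n m j i u v w z h h' hnm hc
    obtain ⟨d, rfl⟩ := Nat.exists_eq_add_of_le hnm
    rcases Sym2.eq_iff.mp h with ⟨rfl, rfl⟩ | ⟨rfl, rfl⟩
    · exact dyad_noncrossing n d j i h' hc
    · exact dyad_noncrossing n d j i (by rw [← h', Sym2.eq_swap]) hc.flip
  rcases le_total n m with hnm | hnm
  · exact key h h' hnm hc
  · exact key h' (by rw [← h, Sym2.eq_swap]) hnm hc.swap

/-- Bisection: otherwise the midpoint of the dyadic interval is strictly between a and b. As (a, b)
is not the whole interval, one end of the interval is not an end of the chord, and joining it to the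
midpoint gives a standard chord that crosses. -/
theorem stdRel_of_not_cross_aux {a b : ℝ} (n : ℕ) (j : ℤ)
    (ha : dyad n j ≤ a) (hb : b ≤ dyad n (j + 1))
    (hn : ∀ w z, StdRel w z → ¬ ChordCross (vmod a) (vmod b) w z)
    (hr : ¬ StdRel (vmod a) (vmod b)) :
    ∃ j', dyad (n + 1) j' ≤ a ∧ b ≤ dyad (n + 1) (j' + 1) := by
  have e1 : dyad (n + 1) (2 * j) = dyad n j := dyad_succ_two_mul n j
  have e2 : dyad (n + 1) (2 * j + 1 + 1) = dyad n (j + 1) := by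
    rw [← dyad_succ_two_mul n (j + 1)]; congr 1; ring
  have e3 := dyad_add_one n j
  have hpi : Real.pi / 2 ^ n ≤ Real.pi := div_le_self Real.pi_pos.le (one_le_pow₀ one_le_two)
  have hpi' := Real.pi_pos
  by_cases h1 : b ≤ dyad (n + 1) (2 * j + 1)
  · exact ⟨2 * j, e1.trans_le ha, h1⟩
  by_cases h2 : dyad (n + 1) (2 * j + 1) ≤ a
  · exact ⟨2 * j + 1, h2, hb.trans_eq e2.symm⟩
  exfalso
  push Not at h1 h2
  rcases ha.lt_or_eq with ha | ha
  · have per : vmod (dyad n j + 2 * Real.pi) = vmod (dyad n j) := by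
      have := vmod_add_mul (dyad n j) 1
      rwa [Int.cast_one, one_mul] at this
    refine hn _ _ ?_ (chordCross_vmod h2 h1 (d := dyad n j + 2 * Real.pi) (by linarith)
      (by linarith))
    rw [per, ← e1]
    exact (stdRel_dyad _ _).symm
  rcases hb.lt_or_eq with hb | hb
  · refine hn _ _ ?_ (chordCross_vmod h2 h1 hb (by linarith))
    rw [← e2]
    exact stdRel_dyad _ _
  · rw [← ha, hb] at hr
    exact hr (stdRel_dyad n j)

/-- Repeated bisection would enclose [a, b] in dyadic intervals of length π / 2 ^ n, eventually
shorter than b - a. -/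
theorem stdRel_of_not_cross_lift {a b : ℝ} (hab : a < b) (j : ℤ)
    (ha : dyad 0 j ≤ a) (hb : b ≤ dyad 0 (j + 1))
    (hn : ∀ w z, StdRel w z → ¬ ChordCross (vmod a) (vmod b) w z) :
    StdRel (vmod a) (vmod b) := by
  by_contra hr
  have key : ∀ n, ∃ j', dyad n j' ≤ a ∧ b ≤ dyad n (j' + 1) := by
    intro n
    induction n with
    | zero => exact ⟨j, ha, hb⟩
    | succ n ih =>
      obtain ⟨j', h1, h2⟩ := ih
      exact stdRel_of_not_cross_aux n j' h1 h2 hn hr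
  obtain ⟨n, hn'⟩ := pow_unbounded_of_one_lt (Real.pi / (b - a)) one_lt_two
  obtain ⟨j', h1, h2⟩ := key n
  rw [dyad_add_one] at h2
  rw [div_lt_iff₀ (by linarith), mul_comm, ← div_lt_iff₀ (by positivity)] at hn'
  linarith

theorem stdRel_of_not_cross {u v : Circ} (huv : u ≠ v)
    (hn : ∀ w z, StdRel w z → ¬ ChordCross u v w z) : StdRel u v := by
  have hsw : ∀ w z, StdRel w z → ¬ ChordCross v u w z := fun w z h hc => hn z w h.symm hc.flip
  wlog hlt : u < v generalizing u v
  · exact (this huv.symm hsw hn (lt_of_le_of_ne (not_lt.mp hlt) huv.symm)).symm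
  obtain ⟨hu1, hu2⟩ := u.2
  obtain ⟨hv1, hv2⟩ := v.2
  rw [← Subtype.coe_lt_coe] at hlt
  have d0 : dyad 0 0 = 0 := by simp [dyad]
  have d1 : dyad 0 (0 + 1) = Real.pi := by simp [dyad]
  have d1' : dyad 0 1 = Real.pi := by simp [dyad]
  have d2 : dyad 0 (1 + 1) = 2 * Real.pi := by norm_num [dyad]
  have hpi := Real.pi_pos
  rw [← vmod_coe u, ← vmod_coe v] at hn hsw ⊢
  -- A chord with ends on both sides of the diameter {0, π} crosses it, unless u = 0; then u is
  -- lifted to 2π and the chord lies in [π, 2π].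
  by_cases h1 : (v : ℝ) ≤ Real.pi
  · exact stdRel_of_not_cross_lift hlt 0 (by linarith) (by linarith) hn
  by_cases h2 : Real.pi ≤ (u : ℝ)
  · exact stdRel_of_not_cross_lift hlt 1 (by linarith) (by linarith) hn
  push Not at h1 h2
  have per : vmod (u + 2 * Real.pi) = vmod u := by
    have := vmod_add_mul u 1
    rwa [Int.cast_one, one_mul] at this
  rcases hu1.lt_or_eq with h0 | h0
  · exfalso
    refine hn _ _ ?_ (chordCross_vmod h2 h1 hv2 (by linarith))
    rw [← d2, ← d1']
    exact stdRel_dyad 0 1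
  · rw [← per] at hsw ⊢
    exact (stdRel_of_not_cross_lift (by linarith) 1 (by linarith) (by linarith) hsw).symm

/-- On the inner side the apex is the midpoint of the dyadic interval. On the outer side it is the
far end of the parent interval, so the parity of j decides; the diameter at level 0 has no parent
and takes the midpoint of the opposite half. -/
theorem stdRel_triangle {u v : Circ} (h : StdRel u v) :
    ∃ w, CycBtw u w v ∧ StdRel u w ∧ StdRel w v := by
  have hM : ∀ n : ℕ, (2 : ℤ) ≤ 2 ^ (n + 1) := fun n => by
    rw [pow_succ]; have : (0 : ℤ) < 2 ^ n := by positivity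
    omega
  obtain ⟨n, j, h⟩ := h
  rcases Sym2.eq_iff.mp h with ⟨rfl, rfl⟩ | ⟨rfl, rfl⟩
  · have e1 : dyad n j = dyad (n + 1) (2 * j) := (dyad_succ_two_mul n j).symm
    have e2 : dyad n (j + 1) = dyad (n + 1) (2 * j + 1 + 1) := by
      rw [← dyad_succ_two_mul n (j + 1)]; congr 1; ring
    rw [e1, e2]
    refine ⟨vmod (dyad (n + 1) (2 * j + 1)), ?_, stdRel_dyad _ _, stdRel_dyad _ _⟩
    have := hM (n + 1)
    have h3 : (2 : ℤ) < 2 ^ (n + 1 + 1) := by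
      rw [pow_succ]; have := hM n; omega
    exact (cycBtw_dyad _ (by omega) (by omega)).mpr ⟨0, by omega, by omega⟩
  · rcases n with _ | n
    · have per : vmod (dyad 0 j) = vmod (dyad 1 (2 * j + 2 + 1 + 1)) := by
        rw [show 2 * j + 2 + 1 + 1 = 2 * (j + 2) by ring, dyad_succ_two_mul]
        exact (vmod_dyad_add_mul 0 j 1).symm
      have e : dyad 0 (j + 1) = dyad 1 (2 * j + 2) := by
        rw [show 2 * j + 2 = 2 * (j + 1) by ring, dyad_succ_two_mul]
      rw [per, e]
      refine ⟨vmod (dyad 1 (2 * j + 2 + 1)), ?_, stdRel_dyad _ _, stdRel_dyad _ _⟩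
      exact (cycBtw_dyad _ (by omega) (by norm_num; omega)).mpr ⟨0, by omega, by omega⟩
    · have h4 : (4 : ℤ) ≤ 2 ^ (n + 1 + 1) := by
        rw [pow_succ]; have := hM n; omega
      have per : ∀ i, vmod (dyad (n + 1) (i + 2 ^ (n + 1 + 1))) = vmod (dyad (n + 1) i) := by
        intro i
        have := vmod_dyad_add_mul (n + 1) i 1
        rwa [one_mul] at this
      rcases Int.even_or_odd' j with ⟨i, rfl | rfl⟩
      · refine ⟨vmod (dyad (n + 1) (2 * i + 1 + 1)), ?_, stdRel_dyad _ _, ?_⟩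
        · rw [← per (2 * i)]
          exact (cycBtw_dyad _ (by omega) (by omega)).mpr ⟨0, by omega, by omega⟩
        · rw [show 2 * i + 1 + 1 = 2 * (i + 1) by ring, dyad_succ_two_mul, dyad_succ_two_mul]
          exact (stdRel_dyad _ _).symm
      · refine ⟨vmod (dyad (n + 1) (2 * i)), ?_, ?_, stdRel_dyad _ _⟩
        · rw [← per (2 * i + 1)]
          exact (cycBtw_dyad _ (by omega) (by omega)).mpr ⟨1, by omega, by omega⟩
        · rw [show 2 * i + 1 + 1 = 2 * (i + 1) by ring, dyad_succ_two_mul, dyad_succ_two_mul]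
          exact (stdRel_dyad _ _).symm

theorem dyad_vmod_ne (n : ℕ) (j : ℤ) : vmod (dyad n j) ≠ vmod (dyad n (j + 1)) := by
  have hpi : Real.pi / 2 ^ n ≤ Real.pi := div_le_self Real.pi_pos.le (one_le_pow₀ one_le_two)
  have hpi' : 0 < Real.pi / 2 ^ n := by positivity
  intro h
  obtain ⟨k, hk⟩ := vmod_eq_iff.mp h
  rw [dyad_add_one] at hk
  have e1 : 0 < k := int_lt_of_mul_pi (by push_cast; linarith)
  have e2 : k < 1 := int_lt_of_mul_pi (by push_cast; linarith [Real.pi_pos])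
  omega

/-- The dyadic triangulation is a triangulation. -/
theorem isTriangulation_stdRel : IsTriangulation StdRel where
  symm _ _ h := h.symm
  ne u v h := by
    obtain ⟨n, j, h⟩ := h
    rcases Sym2.eq_iff.mp h with ⟨rfl, rfl⟩ | ⟨rfl, rfl⟩
    · exact dyad_vmod_ne n j
    · exact (dyad_vmod_ne n j).symm
  noncrossing _ _ _ _ h h' := stdRel_noncrossing h h'
  maximal _ _ h h' := stdRel_of_not_cross h h'
  triangle _ _ h := stdRel_triangle h

/-! ### Standard points as dyadic chords -/

theorem chord_stdPt (n m : ℕ) :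
    chord (stdPt n m).pt = s(vmod (dyad n (m - 1 : ℤ)), vmod (dyad n (m - 1 + 1 : ℤ))) := by
  have e : (stdPt n m).pt.y + Real.pi = dyad n (m - 1 : ℤ) + (1 : ℤ) * (2 * Real.pi) := by
    simp only [stdPt, dyad]
    push_cast
    ring
  have e' : (stdPt n m).pt.x = dyad n (m - 1 + 1 : ℤ) := by
    simp [stdPt, dyad]
  rw [chord, e, e', vmod_add_mul, Sym2.eq_swap]

/-- The chords of the standard points are those of the dyadic triangulation. -/
theorem stdRel_iff {u v : Circ} : StdRel u v ↔
    ∃ n m : ℕ, m < 2 ^ (n + 1) ∧ ¬(n = 0 ∧ m = 1) ∧ chord (stdPt n m).pt = s(u, v) := by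
  constructor
  · rintro ⟨n, j, h⟩
    -- At level 0 every j gives the same diameter, which explains the omission of the index (0, 1).
    by_cases hn : n = 0
    · subst hn
      refine ⟨0, 0, by norm_num, by norm_num, ?_⟩
      rw [chord_stdPt, h]
      have e0 : vmod (dyad 0 (-1)) = vmod (dyad 0 1) := by
        have := vmod_dyad_add_mul 0 (-1) 1
        norm_num at this
        exact this.symm
      rcases Int.even_or_odd' j with ⟨i, rfl | rfl⟩
      · have h0 := vmod_dyad_add_mul 0 0 i
        have h1 := vmod_dyad_add_mul 0 1 i
        rw [show 2 * i = 0 + i * 2 ^ (0 + 1) by ring, h0,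
          show 0 + i * 2 ^ (0 + 1) + 1 = 1 + i * 2 ^ (0 + 1) by ring, h1, Sym2.eq_swap]
        simp [e0]
      · have h0 := vmod_dyad_add_mul 0 0 (i + 1)
        have h1 := vmod_dyad_add_mul 0 1 i
        rw [show 2 * i + 1 + 1 = 0 + (i + 1) * 2 ^ (0 + 1) by ring, h0,
          show 2 * i + 1 = 1 + i * 2 ^ (0 + 1) by ring, h1]
        simp [e0]
    · have hM : (0 : ℤ) < 2 ^ (n + 1) := by positivity
      have hr := Int.emod_nonneg (j + 1) hM.ne'
      have hr' := Int.emod_lt_of_pos (j + 1) hM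
      -- The standard point of index m has the dyadic chord of index m - 1, hence the residue of j +
      -- 1.
      refine ⟨n, ((j + 1) % 2 ^ (n + 1)).toNat, ?_, fun h => hn h.1, ?_⟩
      · zify
        rw [Int.toNat_of_nonneg hr]
        exact hr'
      · rw [chord_stdPt, Int.toNat_of_nonneg hr, h, Int.emod_def]
        have h0 := vmod_dyad_add_mul n (j + 1 - 2 ^ (n + 1) * ((j + 1) / 2 ^ (n + 1)) - 1)
          ((j + 1) / 2 ^ (n + 1))
        have h1 := vmod_dyad_add_mul n (j + 1 - 2 ^ (n + 1) * ((j + 1) / 2 ^ (n + 1)) - 1 + 1)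
          ((j + 1) / 2 ^ (n + 1))
        rw [show ∀ M q : ℤ, j + 1 - M * q - 1 + q * M = j by intros; ring] at h0
        rw [show ∀ M q : ℤ, j + 1 - M * q - 1 + 1 + q * M = j + 1 by intros; ring] at h1
        rw [h0, h1]
  · rintro ⟨n, m, -, -, h⟩
    exact ⟨n, m - 1, by rw [← h, chord_stdPt]⟩

variable {K : Type u} [Field K]

/-! ### Morphisms of the doubled category -/

/-- The condition for a basic morphism from `p` to `q` to exist and to be nonzero. -/
def NonzeroHom (p q : Pt) : Prop :=
  p ≤ q ∧ q.x < p.y + Real.pi ∧ q.y < p.x + Real.pi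

theorem free_embedding_map_ne_zero {p q : Pt} (h : p ⟶ q) {c : K} (hc : c ≠ 0) :
    c • (Free.embedding K Pt).map h ≠ 0 := by
  intro h0
  have : (Finsupp.single h c : (p ⟶ q) →₀ K) = 0 := by
    refine Eq.trans ?_ h0
    change _ = c • Finsupp.single h (1 : K)
    rw [Finsupp.smul_single, smul_eq_mul, mul_one]
  rw [Finsupp.single_eq_zero] at this
  exact hc this

/-- Any r with p ≤ r ≤ q satisfies r.y ≤ q.y < p.x + π ≤ r.x + π, and symmetrically, so no
factorization can leave the strip. -/
theorem factorIdeal_Bpi_eq_zero {p q : Pt} (h : NonzeroHom p q)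
    {f : (Free.embedding K Pt).obj p ⟶ (Free.embedding K Pt).obj q}
    (hf : f ∈ factorIdeal (Bpi K) _ _) : f = 0 := by
  induction hf using AddSubgroup.closure_induction with
  | mem f hf =>
    obtain ⟨_, ⟨r, hr, rfl⟩, g, k, rfl⟩ := hf
    rcases free_eq_smul g with rfl | ⟨h1, c, rfl⟩
    · exact Limits.zero_comp
    rcases free_eq_smul k with rfl | ⟨h2, d, rfl⟩
    · exact Limits.comp_zero
    exfalso
    obtain ⟨-, h3, h4⟩ := h
    obtain ⟨h5, h6⟩ := h1
    obtain ⟨h7, h8⟩ := h2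
    refine hr.not_gt ?_
    rw [abs_lt]
    constructor <;> linarith
  | zero => rfl
  | add f g _ _ hf hg => simp [hf, hg]
  | neg f _ hf => simp [hf]

theorem smul_basic_ne_zero {X Y : D2 K} (h : X.1.pt ≤ Y.1.pt) (hn : NonzeroHom X.1.pt Y.1.pt)
    {c : K} (hc : c ≠ 0) : c • basic h ≠ 0 := by
  intro h0
  have h1 : (c • basic h).hom.hom = (0 : X ⟶ Y).hom.hom := by rw [h0]
  have h2 : (Quotient.functor (idealRel (Bpi K))).map
      (c • (Free.embedding K Pt).map (homOfLE h)) =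
      (Quotient.functor (idealRel (Bpi K))).map 0 := by
    rw [Functor.map_smul, Functor.map_zero]
    exact h1
  rw [Quotient.functor_map_eq_iff] at h2
  have h3 : c • (Free.embedding K Pt).map (homOfLE h) - 0 ∈ factorIdeal (Bpi K) _ _ := h2
  rw [sub_zero] at h3
  exact free_embedding_map_ne_zero _ hc (factorIdeal_Bpi_eq_zero hn h3)

/-- If a bound fails, one of the two other corners of the rectangle from X to Y is outside the
strip, and the basic morphism factors through it. -/
theorem basic_eq_zero {X Y : D2 K} (h : X.1.pt ≤ Y.1.pt) (hn : ¬ NonzeroHom X.1.pt Y.1.pt) :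
    basic h = (0 : X ⟶ Y) := by
  have key : ∃ r : Pt, X.1.pt ≤ r ∧ r ≤ Y.1.pt ∧ Real.pi ≤ |r.y - r.x| := by
    obtain ⟨h1, h2⟩ := h
    by_cases h3 : Y.1.pt.x < X.1.pt.y + Real.pi
    · have h4 : X.1.pt.x + Real.pi ≤ Y.1.pt.y := not_lt.mp fun h4 => hn ⟨⟨h1, h2⟩, h3, h4⟩
      refine ⟨⟨X.1.pt.x, Y.1.pt.y⟩, ⟨le_rfl, h2⟩, ⟨h1, le_rfl⟩, ?_⟩
      exact le_trans (by dsimp only; linarith) (le_abs_self _)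
    · refine ⟨⟨Y.1.pt.x, X.1.pt.y⟩, ⟨h1, le_rfl⟩, ⟨le_rfl, h2⟩, ?_⟩
      exact le_trans (by dsimp only; linarith) (neg_le_abs _)
  obtain ⟨r, h1, h2, h3⟩ := key
  apply InducedCategory.hom_ext
  apply InducedCategory.hom_ext
  change (Quotient.functor (idealRel (Bpi K))).map ((Free.embedding K Pt).map (homOfLE h)) = _
  refine Eq.trans ?_ ((Quotient.functor (idealRel (Bpi K))).map_zero _ _)
  rw [Quotient.functor_map_eq_iff]
  change _ - 0 ∈ factorIdeal (Bpi K) _ _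
  rw [sub_zero]
  refine AddSubgroup.subset_closure ⟨(Free.embedding K Pt).obj r, ⟨r, h3, rfl⟩,
    (Free.embedding K Pt).map (homOfLE h1), (Free.embedding K Pt).map (homOfLE h2), ?_⟩
  rw [← Functor.map_comp, homOfLE_comp]

theorem smul_basic_comp {X Y Z W : D2 K} (h : X.1.pt ≤ Y.1.pt) (h' : Y.1.pt ≤ Z.1.pt)
    (h'' : Z.1.pt ≤ W.1.pt) (c d : K) :
    (c • basic h) ≫ (d • basic h') ≫ basic h'' = (c * d) • basic (h.trans (h'.trans h'')) := by
  rw [Linear.smul_comp, Linear.smul_comp, Linear.comp_smul, smul_smul, basic_comp, basic_comp]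

/-! ### Morphisms of the orbit category -/

/-- The underlying point of an indecomposable object. -/
def pnt (X : Ind K) : Pt := X.obj.1.pt

theorem pnt_lt (X : Ind K) : |(pnt X).y - (pnt X).x| < Real.pi := X.obj.1.lt

/-- The multiple by `c` of the basic morphism `X ⟶ F ^ n Y`, as a morphism of the orbit
category. -/
def homog (X Y : Ind K) (n : ℤ) (h : pnt X ≤ (rot ^ n) (pnt Y)) (c : K) : X ⟶ Y :=
  DirectSum.of (fun n => ShiftedHom X.obj Y.obj n) n
    (c • basic (X := X.obj) (Y := rotObj n Y.obj) h : X.obj ⟶ (rotD2 K n).obj Y.obj)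

theorem shift_map_smul_basic (n : ℤ) {X Y : D2 K} (h : X.1.pt ≤ Y.1.pt) (c : K) :
    (shiftFunctor (D2 K) n).map (c • basic h) =
      c • basic (X := rotObj n X) (Y := rotObj n Y) ((rot ^ n).monotone h) := by
  change (rotD2 K n).map (c • basic h) = _
  rw [Functor.map_smul, rotD2_map_basic]
  rfl

theorem rot_zpow_add (m n : ℤ) (p : Pt) : (rot ^ (n + m)) p = (rot ^ m) ((rot ^ n) p) := by
  rw [add_comm, zpow_add, RelIso.mul_apply]

/-- The coherence isomorphisms of the shift are basic, so composing only adds degrees and multiplies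
scalars. -/
theorem homog_comp {X Y Z : Ind K} {m n : ℤ} (h : pnt X ≤ (rot ^ m) (pnt Y))
    (h' : pnt Y ≤ (rot ^ n) (pnt Z)) (h'' : pnt X ≤ (rot ^ (n + m)) (pnt Z)) (c d : K) :
    homog X Y m h c ≫ homog Y Z n h' d = homog X Z (n + m) h'' (c * d) := by
  refine (orbitComp_of _ _ _ _ _ _ _).trans ?_
  unfold homog
  congr 1
  unfold ShiftedHom.comp
  rw [shiftFunctorAdd'_eq_shiftFunctorAdd]
  have e : (shiftFunctorAdd (D2 K) n m).inv.app Z.obj =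
      basic (X := rotObj m (rotObj n Z.obj)) (Y := rotObj (n + m) Z.obj)
        (rotObj_add n m Z.obj).ge := rfl
  rw [e]
  refine (congrArg₂ (fun a b => a ≫ b ≫ _) rfl (shift_map_smul_basic m h' d)).trans ?_
  exact smul_basic_comp (X := X.obj) (Y := rotObj m Y.obj) (Z := rotObj m (rotObj n Z.obj))
    (W := rotObj (n + m) Z.obj) _ _ _ _ _

theorem homog_ne_zero {X Y : Ind K} {n : ℤ} (h : NonzeroHom (pnt X) ((rot ^ n) (pnt Y))) {c : K}
    (hc : c ≠ 0) : homog X Y n h.1 c ≠ 0 := by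
  intro h0
  refine smul_basic_ne_zero (X := X.obj) (Y := rotObj n Y.obj) h.1 h hc ?_
  refine DirectSum.of_injective (β := fun n => ShiftedHom X.obj Y.obj n) n (h0.trans ?_)
  exact (map_zero _).symm

theorem nonzeroHom_of_homog_ne_zero {X Y : Ind K} {n : ℤ} {h : pnt X ≤ (rot ^ n) (pnt Y)} {c : K}
    (h0 : homog X Y n h c ≠ 0) : NonzeroHom (pnt X) ((rot ^ n) (pnt Y)) := by
  by_contra hn
  refine h0 ?_
  have e := basic_eq_zero (K := K) (X := X.obj) (Y := rotObj n Y.obj) h hn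
  unfold homog
  rw [e]
  refine (congrArg (DirectSum.of (fun n => ShiftedHom X.obj Y.obj n) n) (smul_zero c)).trans ?_
  exact map_zero _

theorem homog_add {X Y : Ind K} {n : ℤ} (h : pnt X ≤ (rot ^ n) (pnt Y)) (c d : K) :
    homog X Y n h (c + d) = homog X Y n h c + homog X Y n h d := by
  unfold homog
  rw [add_smul]
  exact map_add _ _ _

theorem homog_zero {X Y : Ind K} {n : ℤ} (h : pnt X ≤ (rot ^ n) (pnt Y)) :
    homog X Y n h 0 = 0 := by
  have := homog_add h (0 : K) 0
  rw [add_zero] at this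
  exact left_eq_add.mp this

/-- The `x`-coordinates of the points of an orbit increase. -/
theorem rot_zpow_lt {p : Pt} (hp : |p.y - p.x| < Real.pi) (n : ℤ) :
    ((rot ^ n) p).x < ((rot ^ (n + 1)) p).x := by
  have h := abs_lt.mp ((abs_rot_zpow n p).trans_lt hp)
  rw [add_comm, zpow_add, zpow_one, RelIso.mul_apply]
  change _ < ((rot ^ n) p).y + Real.pi
  linarith

theorem rot_zpow_succ_x (n : ℤ) (p : Pt) :
    ((rot ^ (n + 1)) p).x = ((rot ^ n) p).y + Real.pi := by
  rw [add_comm, zpow_add, zpow_one, RelIso.mul_apply]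
  rfl

theorem rot_zpow_strictMono {p : Pt} (hp : |p.y - p.x| < Real.pi) :
    StrictMono fun n : ℤ => ((rot ^ n) p).x :=
  strictMono_int_of_lt_succ (rot_zpow_lt hp)

/-- If m < n, then the x-coordinate of `(rot ^ n) q` is at least the y-coordinate of `(rot ^ m) q`
plus π, hence at least p.y + π, which is out of range. Thus Hom spaces of the orbit category live in
a single degree. -/
theorem NonzeroHom.unique {p q : Pt} (hq : |q.y - q.x| < Real.pi) {m n : ℤ}
    (h : NonzeroHom p ((rot ^ m) q)) (h' : NonzeroHom p ((rot ^ n) q)) : m = n := by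
  have key : ∀ {m n : ℤ}, NonzeroHom p ((rot ^ m) q) → NonzeroHom p ((rot ^ n) q) → ¬ m < n := by
    rintro m n ⟨⟨h1, h2⟩, h3, h4⟩ ⟨⟨h5, h6⟩, h7, h8⟩ hlt
    have h9 := (rot_zpow_strictMono hq).monotone (show m + 1 ≤ n by omega)
    simp only [rot_zpow_succ_x] at h9
    linarith
  have h1 := key h h'
  have h2 := key h' h
  omega

/-- Every nonzero morphism between indecomposable objects is a multiple of a basic one. -/
theorem hom_cases {X Y : Ind K} (f : X ⟶ Y) (hf : f ≠ 0) :
    ∃ (n : ℤ) (h : NonzeroHom (pnt X) ((rot ^ n) (pnt Y))) (c : K), c ≠ 0 ∧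
      f = homog X Y n h.1 c := by
  have key : ∀ f : X ⟶ Y, f = 0 ∨
      ∃ (n : ℤ) (h : NonzeroHom (pnt X) ((rot ^ n) (pnt Y))) (c : K), f = homog X Y n h.1 c := by
    intro f
    induction f using DirectSum.induction_on with
    | zero => exact Or.inl rfl
    | of n f =>
      rcases eq_smul_basic (X := X.obj) (Y := rotObj n Y.obj) f with rfl | ⟨h, c, rfl⟩
      · exact Or.inl (map_zero _)
      · by_cases hn : NonzeroHom (pnt X) ((rot ^ n) (pnt Y))
        · exact Or.inr ⟨n, hn, c, rfl⟩
        · left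
          by_contra h0
          exact hn (nonzeroHom_of_homog_ne_zero (h := h) (c := c) h0)
    | add f g hf hg =>
      rcases hf with rfl | ⟨n, h, c, rfl⟩
      · rcases hg with rfl | ⟨m, h', d, rfl⟩
        · exact Or.inl (add_zero _)
        · exact Or.inr ⟨m, h', d, zero_add _⟩
      · rcases hg with rfl | ⟨m, h', d, rfl⟩
        · exact Or.inr ⟨n, h, c, add_zero _⟩
        · obtain rfl := h.unique (pnt_lt Y) h'
          exact Or.inr ⟨n, h, c + d, (homog_add _ _ _).symm⟩
  rcases key f with h | ⟨n, h, c, rfl⟩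
  · exact absurd h hf
  · refine ⟨n, h, c, ?_, rfl⟩
    rintro rfl
    exact hf (homog_zero _)

theorem exists_hom_ne_zero_iff {X Y : Ind K} :
    (∃ f : X ⟶ Y, f ≠ 0) ↔ ∃ n : ℤ, NonzeroHom (pnt X) ((rot ^ n) (pnt Y)) := by
  constructor
  · rintro ⟨f, hf⟩
    obtain ⟨n, h, -⟩ := hom_cases f hf
    exact ⟨n, h⟩
  · rintro ⟨n, h⟩
    exact ⟨_, homog_ne_zero h one_ne_zero⟩

theorem nonzeroHom_self {p : Pt} (hp : |p.y - p.x| < Real.pi) : NonzeroHom p p := by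
  rw [abs_lt] at hp
  exact ⟨le_rfl, by linarith, by linarith⟩

theorem le_rot_zpow_zero (p : Pt) : p ≤ (rot ^ (0 : ℤ)) p := by
  rw [zpow_zero]
  exact le_rfl

theorem id_eq_homog (X : Ind K) : 𝟙 X = homog X X 0 (le_rot_zpow_zero _) 1 := by
  unfold homog
  rw [one_smul]
  change DirectSum.of (fun n => ShiftedHom X.obj X.obj n) 0
    (ShiftedHom.mk₀ 0 rfl (𝟙 X.obj)) = _
  congr 1
  unfold ShiftedHom.mk₀ shiftFunctorZero'
  simp only [eqToIso_refl, Iso.refl_trans]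
  have e : (shiftFunctorZero (D2 K) ℤ).inv.app X.obj =
      basic (X := X.obj) (Y := rotObj 0 X.obj) (rotObj_zero X.obj).ge := rfl
  rw [e]
  exact Category.id_comp _

theorem id_ne_zero (X : Ind K) : 𝟙 X ≠ 0 := by
  have h : NonzeroHom (pnt X) ((rot ^ (0 : ℤ)) (pnt X)) := by
    rw [zpow_zero]
    exact nonzeroHom_self (pnt_lt X)
  rw [id_eq_homog]
  exact homog_ne_zero h one_ne_zero

theorem homog_congr {X Y : Ind K} {m n : ℤ} (e : m = n) (h : pnt X ≤ (rot ^ m) (pnt Y))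
    (h' : pnt X ≤ (rot ^ n) (pnt Y)) (c : K) : homog X Y m h c = homog X Y n h' c := by
  subst e
  rfl

/-- For inverse isomorphisms of degrees n and m, the composite is a nonzero endomorphism, so m + n =
0 by uniqueness of the degree; the two inequalities between X and the translate of Y then force
equality. -/
theorem iso_iff_rot {X Y : Ind K} :
    Nonempty (X ≅ Y) ↔ ∃ n : ℤ, pnt X = (rot ^ n) (pnt Y) := by
  constructor
  · rintro ⟨e⟩
    have hid := e.hom_inv_id
    have hne : e.hom ≫ e.inv ≠ 0 := by rw [hid]; exact id_ne_zero X
    have hf : e.hom ≠ 0 := fun h => hne (by rw [h, Limits.zero_comp])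
    have hg : e.inv ≠ 0 := fun h => hne (by rw [h, Limits.comp_zero])
    obtain ⟨n, h, c, hc, hf'⟩ := hom_cases _ hf
    obtain ⟨m, h', d, hd, hg'⟩ := hom_cases _ hg
    have h1 : pnt X ≤ (rot ^ (m + n)) (pnt X) := by
      rw [rot_zpow_add]
      exact h.1.trans ((rot ^ n).monotone h'.1)
    have h2 : NonzeroHom (pnt X) ((rot ^ (m + n)) (pnt X)) := by
      apply nonzeroHom_of_homog_ne_zero (h := h1) (c := c * d)
      rwa [← homog_comp h.1 h'.1, ← hf', ← hg']
    have h3 : NonzeroHom (pnt X) ((rot ^ (0 : ℤ)) (pnt X)) := by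
      rw [zpow_zero]
      exact nonzeroHom_self (pnt_lt X)
    have h4 := h2.unique (pnt_lt X) h3
    refine ⟨n, le_antisymm h.1 ?_⟩
    have h5 := (rot ^ n).monotone h'.1
    rw [← rot_zpow_add, h4, zpow_zero] at h5
    exact h5
  · rintro ⟨n, hn⟩
    have hn' : pnt Y = (rot ^ (-n)) (pnt X) := by
      rw [hn, ← rot_zpow_add]
      simp
    refine ⟨⟨homog X Y n hn.le 1, homog Y X (-n) hn'.le 1, ?_, ?_⟩⟩
    · rw [homog_comp _ _ (by simp), id_eq_homog, mul_one]
      exact homog_congr (by simp) _ _ _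
    · rw [homog_comp _ _ (by simp), id_eq_homog, mul_one]
      exact homog_congr (by simp) _ _ _

theorem iso_iff_chord {X Y : Ind K} : Nonempty (X ≅ Y) ↔ chord (pnt X) = chord (pnt Y) := by
  rw [iso_iff_rot, chord_eq_iff (pnt_lt X) (pnt_lt Y)]

theorem NonzeroHom.rot {p q : Pt} (h : NonzeroHom p q) : NonzeroHom (rot p) (rot q) := by
  obtain ⟨h1, h2, h3⟩ := h
  refine ⟨(ContinuousCluster.rot).monotone h1, ?_, ?_⟩
  · change q.y + Real.pi < p.x + Real.pi + Real.pi
    linarith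
  · change q.x + Real.pi < p.y + Real.pi + Real.pi
    linarith

theorem NonzeroHom.rot_symm {p q : Pt} (h : NonzeroHom p q) :
    NonzeroHom (ContinuousCluster.rot⁻¹ p) (ContinuousCluster.rot⁻¹ q) := by
  obtain ⟨h1, h2, h3⟩ := h
  refine ⟨(ContinuousCluster.rot⁻¹).monotone h1, ?_, ?_⟩
  · change q.y - Real.pi < p.x - Real.pi + Real.pi
    linarith
  · change q.x - Real.pi < p.y - Real.pi + Real.pi
    linarith

theorem NonzeroHom.rot_zpow {p q : Pt} (h : NonzeroHom p q) (n : ℤ) :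
    NonzeroHom ((ContinuousCluster.rot ^ n) p) ((ContinuousCluster.rot ^ n) q) := by
  induction n generalizing p q with
  | zero => simpa using h
  | succ n ih =>
    rw [zpow_add_one]
    exact ih h.rot
  | pred n ih =>
    rw [zpow_sub_one]
    exact ih h.rot_symm

/-! ### Compatibility and crossing -/

/-- Nonzero morphisms both ways place a translate of Y between X and its translate by `rot ^ (m +
n)`, where only m + n = 0 or 1 is possible. The value 0 gives an isomorphism; for 1, nonvanishing of
the two morphisms gives the four strict inequalities of a crossing. -/
theorem compatible_of_not_crosses {X Y : Ind K} (hXY : IsEmpty (X ≅ Y))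
    (h : ¬ Crosses (pnt X) (pnt Y)) : Compatible K X Y := by
  by_contra hc
  unfold Compatible at hc
  push Not at hc
  obtain ⟨hf, hg⟩ := hc
  obtain ⟨n, ⟨⟨h1, h2⟩, h3, h4⟩⟩ := exists_hom_ne_zero_iff.mp hf
  obtain ⟨m, h'⟩ := exists_hom_ne_zero_iff.mp hg
  have h5 := h'.rot_zpow n
  rw [← rot_zpow_add] at h5
  obtain ⟨⟨h5, h6⟩, h7, h8⟩ := h5
  have hX := rot_zpow_strictMono (pnt_lt X)
  have e0 : ((rot ^ (0 : ℤ)) (pnt X)) = pnt X := by simp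
  have e1 : ((rot ^ (0 + 1 : ℤ)) (pnt X)).x = (pnt X).y + Real.pi := by
    rw [rot_zpow_succ_x, e0]
  have e2 : ((rot ^ (0 + 1 + 1 : ℤ)) (pnt X)).x = (pnt X).x + Real.pi + Real.pi := by
    rw [rot_zpow_succ_x, rot_zpow_add, e0]
    rfl
  have i1 : -1 < m + n := by
    by_contra hlt
    have := hX (show m + n < 0 by omega)
    simp only [e0] at this
    linarith
  have i2 : m + n < 2 := by
    have : ((rot ^ (m + n)) (pnt X)).x < ((rot ^ (0 + 1 + 1 : ℤ)) (pnt X)).x := by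
      rw [e2]
      linarith
    exact hX.lt_iff_lt.mp this
  have i3 : m + n = 0 ∨ m + n = 1 := by omega
  rcases i3 with i3 | i3
  · rw [i3, e0] at h5 h6
    have h9 : pnt X = (rot ^ n) (pnt Y) := Pt.ext (le_antisymm h1 h5) (le_antisymm h2 h6)
    exact hXY.elim (iso_iff_rot.mpr ⟨n, h9⟩).some
  · have e3 : (rot ^ (1 : ℤ)) (pnt X) = rot (pnt X) := by rw [zpow_one]
    rw [i3, e3] at h5 h6 h7 h8
    change _ ≤ (pnt X).y + Real.pi at h5
    change _ ≤ (pnt X).x + Real.pi at h6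
    change (pnt X).y + Real.pi < _ at h7
    change (pnt X).x + Real.pi < _ at h8
    exact h ⟨n, by linarith, h3, by linarith, h4⟩

/-- A crossing puts a translate of Y strictly between X and `rot` of X, giving nonzero morphisms of
degree n to Y and degree 1 - n back. -/
theorem not_crosses_of_compatible {X Y : Ind K} (hc : Compatible K X Y) :
    ¬ Crosses (pnt X) (pnt Y) := by
  rintro ⟨n, h1, h2, h3, h4⟩
  have hf : ∃ f : X ⟶ Y, f ≠ 0 :=
    exists_hom_ne_zero_iff.mpr ⟨n, ⟨h1.le, h3.le⟩, h2, h4⟩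
  have hg : ∃ g : Y ⟶ X, g ≠ 0 := by
    refine exists_hom_ne_zero_iff.mpr ⟨-n + 1, ?_⟩
    have h5 : NonzeroHom ((rot ^ n) (pnt Y)) (rot (pnt X)) := by
      refine ⟨⟨h2.le, h4.le⟩, ?_, ?_⟩
      · change (pnt X).y + Real.pi < _
        linarith
      · change (pnt X).x + Real.pi < _
        linarith
    have h6 := h5.rot_zpow (-n)
    rw [← rot_zpow_add] at h6
    have e : rot (pnt X) = (rot ^ (1 : ℤ)) (pnt X) := by rw [zpow_one]
    rw [e, ← rot_zpow_add] at h6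
    simpa [add_comm] using h6
  obtain ⟨f, hf⟩ := hf
  obtain ⟨g, hg⟩ := hg
  rcases hc with hc | hc
  · exact hf (hc f)
  · exact hg (hc g)

/-! ### Clusters and triangulations -/

/-- The chords of the objects of `T`. -/
def chordRel (T : Set (Ind K)) (u v : Circ) : Prop := ∃ X ∈ T, chord (pnt X) = s(u, v)

/-- `T` is a set of representatives for the chords of a triangulation. -/
structure IsTriangulating (T : Set (Ind K)) : Prop where
  tri : IsTriangulation (chordRel T)
  inj : ∀ X ∈ T, ∀ Y ∈ T, chord (pnt X) = chord (pnt Y) → X = Y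

theorem not_chordCross_self {u v w z : Circ} (h : s(u, v) = s(w, z)) : ¬ ChordCross u v w z := by
  intro hc
  rw [Sym2.eq_iff] at h
  unfold ChordCross CycBtw at hc
  grind

theorem pnt_crosses_iff {X Y : Ind K} : Crosses (pnt X) (pnt Y) ↔
    ∃ w z : Circ, chord (pnt Y) = s(w, z) ∧
      ChordCross (vmod (pnt X).x) (vmod ((pnt X).y + Real.pi)) w z :=
  crosses_iff (pnt_lt X) (pnt_lt Y)

theorem not_crosses_of_chord_eq {X Y : Ind K} (h : chord (pnt X) = chord (pnt Y)) :
    ¬ Crosses (pnt X) (pnt Y) := by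
  rw [pnt_crosses_iff]
  rintro ⟨w, z, h1, h2⟩
  exact not_chordCross_self (h.trans h1) h2

theorem crosses_congr {X Y Y' : Ind K} (h : chord (pnt Y) = chord (pnt Y')) :
    Crosses (pnt X) (pnt Y) ↔ Crosses (pnt X) (pnt Y') := by
  rw [pnt_crosses_iff, pnt_crosses_iff, h]

theorem Crosses.symm {X Y : Ind K} (h : Crosses (pnt X) (pnt Y)) : Crosses (pnt Y) (pnt X) := by
  obtain ⟨w, z, h1, h2⟩ := pnt_crosses_iff.mp h
  rcases Sym2.eq_iff.mp h1 with ⟨rfl, rfl⟩ | ⟨rfl, rfl⟩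
  · exact pnt_crosses_iff.mpr ⟨_, _, Sym2.eq_swap, h2.swap⟩
  · exact pnt_crosses_iff.mpr ⟨_, _, rfl, h2.swap.flip⟩

/-- Maximality is that of the triangulation. For discreteness, the chord of any point close enough
to X still crosses the other diagonal of the quadrilateral around X, and X is the only object of T
whose chord does so. -/
theorem IsTriangulating.isCluster {T : Set (Ind K)} (hT : IsTriangulating T) :
    IsCluster K T where
  maximal := by
    refine ⟨?_, ?_⟩
    · intro X hX Y hY hne
      have he : IsEmpty (X ≅ Y) := by
        refine ⟨fun e => hne (hT.inj X hX Y hY (iso_iff_chord.mp ⟨e⟩))⟩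
      refine ⟨he, compatible_of_not_crosses he fun hc => ?_⟩
      obtain ⟨w, z, h1, h2⟩ := pnt_crosses_iff.mp hc
      exact hT.tri.noncrossing _ _ _ _ ⟨X, hX, rfl⟩ ⟨Y, hY, h1⟩ h2
    · intro U hU hTU Y hY
      have hr : chordRel T (vmod (pnt Y).x) (vmod ((pnt Y).y + Real.pi)) := by
        refine hT.tri.maximal _ _ (chord_ends_ne (pnt_lt Y)) ?_
        rintro w z ⟨X, hX, hX'⟩ hc
        have hcr : Crosses (pnt Y) (pnt X) := pnt_crosses_iff.mpr ⟨w, z, hX', hc⟩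
        by_cases hXY : Y = X
        · subst hXY
          exact not_crosses_of_chord_eq rfl hcr
        · exact not_crosses_of_compatible (hU hY (hTU hX) hXY).2 hcr
      obtain ⟨X, hX, hX'⟩ := hr
      by_cases hXY : X = Y
      · rwa [← hXY]
      · exact ((hU (hTU hX) hY hXY).1.false (iso_iff_chord.mpr hX').some).elim
  discrete := by
    intro X hX
    have hx := abs_lt.mp (pnt_lt X)
    have per : vmod ((pnt X).x + 2 * Real.pi) = vmod (pnt X).x := by
      have := vmod_add_mul (pnt X).x 1
      rwa [Int.cast_one, one_mul] at this
    obtain ⟨a, r, hq⟩ := exists_isQuad hT.tri (p := vmod (pnt X).x)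
      (q := vmod ((pnt X).y + Real.pi)) ⟨X, hX, rfl⟩
    have ha := hq.cyc_left
    have hr := hq.cyc_right
    rw [← vmod_coe a, cycBtw_vmod_iff _ (by linarith) (by linarith)] at ha
    rw [← vmod_coe r, ← per, cycBtw_vmod_iff _ (by linarith) (by linarith)] at hr
    obtain ⟨k, hk1, hk2⟩ := ha
    obtain ⟨l, hl1, hl2⟩ := hr
    set c := (a : ℝ) + k * (2 * Real.pi) with hc
    set d := (r : ℝ) + l * (2 * Real.pi) with hd
    have hca : vmod c = a := by rw [hc, vmod_add_mul, vmod_coe]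
    have hdr : vmod d = r := by rw [hd, vmod_add_mul, vmod_coe]
    -- The radius is the least distance along the line from the lifted ends of the chord to the two
    -- opposite vertices c and d.
    refine ⟨min (min (c - (pnt X).x) ((pnt X).y + Real.pi - c))
      (min (d - ((pnt X).y + Real.pi)) ((pnt X).x + 2 * Real.pi - d)), ?_, ?_⟩
    · refine lt_min (lt_min ?_ ?_) (lt_min ?_ ?_) <;> linarith
    · rintro Y hY ⟨p, hp, hp'⟩
      simp only [lt_min_iff] at hp
      obtain ⟨⟨h1, h2⟩, h3, h4⟩ := hp
      change |(pnt X).x - p.pt.x| + |(pnt X).y - p.pt.y| < _ at h1 h2 h3 h4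
      have a1 := abs_nonneg ((pnt X).x - p.pt.x)
      have a2 := abs_nonneg ((pnt X).y - p.pt.y)
      have b1 := le_abs_self ((pnt X).x - p.pt.x)
      have b2 := le_abs_self ((pnt X).y - p.pt.y)
      have b3 := neg_abs_le ((pnt X).x - p.pt.x)
      have b4 := neg_abs_le ((pnt X).y - p.pt.y)
      have hcr : ChordCross (vmod p.pt.x) (vmod (p.pt.y + Real.pi)) (vmod c) (vmod d) :=
        chordCross_vmod (by linarith) (by linarith) (by linarith) (by linarith)
      rw [hca, hdr] at hcr
      have hch : chord (pnt Y) = chord p.pt := iso_iff_chord.mp hp'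
      obtain ⟨e1, e2⟩ := hq.eq_diag_of_cross hT.tri hcr.swap
        (hT.tri.symm _ _ ⟨Y, hY, hch⟩)
      refine hT.inj Y hY X hX (hch.trans ?_)
      rw [chord, e1, e2]
      rfl

theorem chordRel_flip {T : Set (Ind K)} (hT : IsTriangulating T) {p q a r : Circ}
    {X X' : Ind K} (hX : X ∈ T) (hXc : chord (pnt X) = s(p, q))
    (hX' : chord (pnt X') = s(a, r)) :
    chordRel (insert X' (T \ {X})) = flipRel (chordRel T) p q a r := by
  ext u v
  constructor
  · rintro ⟨Y, rfl | ⟨hY, hYX⟩, hYc⟩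
    · exact Or.inr (hYc.symm.trans hX')
    · refine Or.inl ⟨⟨Y, hY, hYc⟩, fun h => hYX ?_⟩
      exact hT.inj Y hY X hX (hYc.trans (h.trans hXc.symm))
  · rintro (⟨⟨Y, hY, hYc⟩, hne⟩ | h)
    · refine ⟨Y, Or.inr ⟨hY, ?_⟩, hYc⟩
      rintro rfl
      exact hne (hYc.symm.trans hXc)
    · exact ⟨X', Or.inl rfl, hX'.trans h.symm⟩

/-- Flips are mutations. -/
theorem IsTriangulating.flip {T : Set (Ind K)} (hT : IsTriangulating T) {p q a r : Circ}
    (hq : IsQuad (chordRel T) p q a r) {X X' : Ind K} (hX : X ∈ T)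
    (hXc : chord (pnt X) = s(p, q)) (hX' : chord (pnt X') = s(a, r)) :
    IsTriangulating (insert X' (T \ {X})) ∧ IsMutation K T (insert X' (T \ {X})) := by
  have hnot : ∀ Y ∈ T, chord (pnt Y) ≠ s(a, r) := fun Y hY hYc =>
    hT.tri.noncrossing _ _ _ _ hq.diag ⟨Y, hY, hYc⟩ hq.other_cross
  have htri : IsTriangulating (insert X' (T \ {X})) := by
    refine ⟨?_, ?_⟩
    · rw [chordRel_flip hT hX hXc hX']
      exact hq.flip hT.tri
    · rintro Y (rfl | ⟨hY, hYX⟩) Z (rfl | ⟨hZ, hZX⟩) h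
      · rfl
      · exact absurd (h.symm.trans hX') (hnot Z hZ)
      · exact absurd (h.trans hX') (hnot Y hY)
      · exact hT.inj Y hY Z hZ h
  refine ⟨htri, X, hX, X', ⟨fun e => ?_⟩, rfl, htri.isCluster⟩
  exact hnot X hX ((iso_iff_chord.mp ⟨e⟩).symm.trans hX')

/-! ### Rational objects and finite crossing -/

theorem finite_chordCross {T : Set (Ind K)} {X : Ind K}
    (hfin : {Y ∈ T | Crosses (pnt X) (pnt Y)}.Finite) :
    {c : Circ × Circ | chordRel T c.1 c.2 ∧
      ChordCross c.1 c.2 (vmod (pnt X).x) (vmod ((pnt X).y + Real.pi))}.Finite := by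
  refine (hfin.biUnion (t := fun Y => {c : Circ × Circ | chord (pnt Y) = s(c.1, c.2)})
    fun Y _ => ?_).subset ?_
  · refine (Set.toFinite {(vmod (pnt Y).x, vmod ((pnt Y).y + Real.pi)),
      (vmod ((pnt Y).y + Real.pi), vmod (pnt Y).x)}).subset ?_
    rintro ⟨c, d⟩ (h : _ = _)
    rcases Sym2.eq_iff.mp h with ⟨rfl, rfl⟩ | ⟨rfl, rfl⟩
    · exact Or.inl rfl
    · exact Or.inr rfl
  · rintro ⟨c, d⟩ ⟨⟨Y, hY, hYc⟩, hc⟩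
    simp only [Set.mem_iUnion]
    refine ⟨Y, ⟨hY, pnt_crosses_iff.mpr ⟨d, c, ?_, hc.swap.flip.flip⟩⟩, hYc⟩
    rw [Sym2.eq_swap]
    exact hYc

/-- An object whose chord crosses only finitely many chords of a cluster reached by flips is
rational. -/
theorem isRational_of_finite_crosses {X : Ind K} (n : ℕ) {T : Set (Ind K)}
    (hT : IsTriangulating T) (hreach : Relation.ReflTransGen (IsMutation K) (stdCluster K) T)
    (hfin : {Y ∈ T | Crosses (pnt X) (pnt Y)}.Finite)
    (hn : {Y ∈ T | Crosses (pnt X) (pnt Y)}.ncard = n) : IsRational K X := by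
  induction n using Nat.strong_induction_on generalizing T with
  | _ n ih =>
    by_cases hne : {c : Circ × Circ | chordRel T c.1 c.2 ∧
      ChordCross c.1 c.2 (vmod (pnt X).x) (vmod ((pnt X).y + Real.pi))}.Nonempty
    · obtain ⟨p, q, r, hq, hc⟩ := exists_isQuad_of_cross hT.tri (finite_chordCross hfin) hne
      obtain ⟨Y, hY, hYc⟩ := hq.diag
      have har : vmod (pnt X).x ≠ r := by
        have h1 := hq.other_cross
        unfold ChordCross CycBtw at h1
        grind
      obtain ⟨P, hP⟩ := exists_chord_eq har
      obtain ⟨hT', hmut⟩ := hT.flip hq hY hYc (X' := M K P) hP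
      have hYX : Crosses (pnt X) (pnt Y) :=
        pnt_crosses_iff.mpr ⟨q, p, by rw [hYc, Sym2.eq_swap], hc.swap⟩
      -- The flip exchanges Y, which crosses X, for a chord sharing an endpoint with X, which does
      -- not.
      have hsub : {Z ∈ insert (M K P) (T \ {Y}) | Crosses (pnt X) (pnt Z)} ⊂
          {Z ∈ T | Crosses (pnt X) (pnt Z)} := by
        refine ⟨?_, fun h => ?_⟩
        · rintro Z ⟨rfl | hZ, hZc⟩
          · exfalso
            obtain ⟨w, z, h1, h2⟩ := pnt_crosses_iff.mp hZc
            have h3 := Sym2.eq_iff.mp ((show chord (pnt (M K P)) = _ from hP).symm.trans h1)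
            unfold ChordCross CycBtw at h2
            grind
          · exact ⟨hZ.1, hZc⟩
        · obtain ⟨h1 | h1, -⟩ := h ⟨hY, hYX⟩
          · have h2 : s(p, q) = s(vmod (pnt X).x, r) := by
              rw [← hYc, h1]
              exact hP
            exact not_chordCross_self h2 hq.other_cross
          · exact h1.2 rfl
      exact ih _ (hn ▸ Set.ncard_lt_ncard hsub hfin) hT' (hreach.tail hmut)
        (hfin.subset hsub.subset) rfl
    · have hr : chordRel T (vmod (pnt X).x) (vmod ((pnt X).y + Real.pi)) := by
        refine hT.tri.maximal _ _ (chord_ends_ne (pnt_lt X)) fun w z hwz hc => hne ?_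
        exact ⟨(z, w), hT.tri.symm _ _ hwz, hc.swap.flip.flip.flip⟩
      obtain ⟨Y, hY, hYc⟩ := hr
      exact ⟨T, hreach, Y, hY, iso_iff_chord.mpr hYc.symm⟩

theorem stdPt_sub (n m : ℕ) :
    (stdPt n m).pt.y - (stdPt n m).pt.x = Real.pi - Real.pi / 2 ^ n := by
  simp only [stdPt]
  ring

theorem pi_div_two_pow_le (n : ℕ) : Real.pi / 2 ^ n ≤ Real.pi :=
  div_le_self Real.pi_pos.le (one_le_pow₀ one_le_two)

theorem pi_div_two_pow_inj {n n' : ℕ} (h : Real.pi / 2 ^ n = Real.pi / 2 ^ n') : n = n' := by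
  rw [div_eq_div_iff (by positivity) (by positivity)] at h
  have h2 : (2 : ℝ) ^ n' = 2 ^ n := mul_left_cancel₀ Real.pi_ne_zero h
  exact (Nat.pow_right_injective le_rfl (by exact_mod_cast h2)).symm

/-- The difference y - x = π - π / 2 ^ n determines n. Even powers of `rot` shift m by multiples of
2 ^ (n + 1). Odd powers negate the nonnegative difference y - x, so n = n' = 0, where only m = 0 is
allowed. -/
theorem stdPt_inj {n m n' m' : ℕ} (hm : m < 2 ^ (n + 1)) (hm' : m' < 2 ^ (n' + 1))
    (h0 : ¬(n = 0 ∧ m = 1)) (h0' : ¬(n' = 0 ∧ m' = 1))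
    (h : chord (stdPt n m).pt = chord (stdPt n' m').pt) : n = n' ∧ m = m' := by
  obtain ⟨k, hk⟩ := (chord_eq_iff (stdPt n m).lt (stdPt n' m').lt).mp h
  have hs := stdPt_sub n m
  have hs' := stdPt_sub n' m'
  rcases Int.even_or_odd' k with ⟨i, rfl | rfl⟩
  · rw [rot_zpow_two_mul] at hk
    rw [hk] at hs
    dsimp only at hs
    obtain rfl : n = n' := pi_div_two_pow_inj (by linarith)
    refine ⟨rfl, ?_⟩
    have hx : (stdPt n m).pt.x = _ := congrArg Pt.x hk
    dsimp only at hx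
    have e1 : dyad n m = dyad n (m' + i * 2 ^ (n + 1)) := by
      rw [dyad_add_mul]
      simpa [stdPt, dyad] using hx
    have e2 : (m : ℤ) = m' + i * 2 ^ (n + 1) := by
      rcases lt_trichotomy (m : ℤ) (m' + i * 2 ^ (n + 1)) with h | h | h
      · exact absurd e1 (dyad_lt_iff.mpr h).ne
      · exact h
      · exact absurd e1 (dyad_lt_iff.mpr h).ne'
    zify at hm hm'
    have hM : (0 : ℤ) < 2 ^ (n + 1) := by positivity
    have i1 : -1 < i := lt_of_mul_lt_mul_right (a := 2 ^ (n + 1)) (by omega) hM.le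
    have i2 : i < 1 := lt_of_mul_lt_mul_right (a := 2 ^ (n + 1)) (by omega) hM.le
    obtain rfl : i = 0 := by omega
    omega
  · rw [rot_zpow_two_mul_add_one] at hk
    rw [hk] at hs
    dsimp only at hs
    have l1 := pi_div_two_pow_le n
    have l2 := pi_div_two_pow_le n'
    have n0 : n = 0 := pi_div_two_pow_inj (n' := 0) (by rw [pow_zero, div_one]; linarith)
    have n0' : n' = 0 := pi_div_two_pow_inj (n' := 0) (by rw [pow_zero, div_one]; linarith)
    subst n0 n0'
    omega

theorem chordRel_stdCluster : chordRel (stdCluster K) = StdRel := by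
  ext u v
  rw [stdRel_iff]
  constructor
  · rintro ⟨_, ⟨n, m, h1, h2, rfl⟩, h3⟩
    exact ⟨n, m, h1, h2, h3⟩
  · rintro ⟨n, m, h1, h2, h3⟩
    exact ⟨_, ⟨n, m, h1, h2, rfl⟩, h3⟩

theorem isTriangulating_stdCluster : IsTriangulating (stdCluster K) where
  tri := by
    rw [chordRel_stdCluster]
    exact isTriangulation_stdRel
  inj := by
    rintro _ ⟨n, m, h1, h2, rfl⟩ _ ⟨n', m', h1', h2', rfl⟩ h
    obtain ⟨rfl, rfl⟩ := stdPt_inj h1 h1' h2 h2' h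
    rfl

/-- Only finitely many objects of the standard cluster are lost by finitely many mutations. -/
theorem finite_diff_of_reachable {T : Set (Ind K)}
    (h : Relation.ReflTransGen (IsMutation K) (stdCluster K) T) :
    IsCluster K T ∧ (stdCluster K \ T).Finite := by
  induction h with
  | refl => exact ⟨isTriangulating_stdCluster.isCluster, by simp⟩
  | tail _ hmut ih =>
    obtain ⟨X, hX, X', -, rfl, hcl⟩ := hmut
    refine ⟨hcl, (ih.2.insert X).subset ?_⟩
    rintro S ⟨hS, hS'⟩
    by_cases hSX : S = X
    · exact Or.inl hSX
    · exact Or.inr ⟨hS, fun h => hS' (Or.inr ⟨h, hSX⟩)⟩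

/-- An indecomposable object is rational iff its chord crosses finitely many chords of the
standard cluster. -/
theorem isRational_iff {X : Ind K} :
    IsRational K X ↔ {S ∈ stdCluster K | Crosses (pnt S) (pnt X)}.Finite := by
  constructor
  · rintro ⟨T, hT, Y, hY, hXY⟩
    obtain ⟨hcl, hfin⟩ := finite_diff_of_reachable hT
    refine hfin.subset ?_
    rintro S ⟨hS, hc⟩
    -- An S remaining in T equals Y or is compatible with it, so it cannot cross.
    refine ⟨hS, fun hST => ?_⟩
    rw [crosses_congr (Y' := Y) (iso_iff_chord.mp hXY)] at hc
    by_cases hSY : S = Y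
    · subst hSY
      exact not_crosses_of_chord_eq rfl hc
    · exact not_crosses_of_compatible (hcl.maximal.1 hST hY hSY).2 hc
  · intro h
    refine isRational_of_finite_crosses _ isTriangulating_stdCluster .refl (h.subset ?_) rfl
    rintro S ⟨hS, hc⟩
    exact ⟨hS, hc.symm⟩

/-- An indecomposable object whose chord crosses no chord of the standard cluster is isomorphic
to an object of the standard cluster. -/
theorem exists_iso_of_not_crosses {X : Ind K}
    (h : ∀ S ∈ stdCluster K, ¬ Crosses (pnt S) (pnt X)) :
    ∃ S ∈ stdCluster K, Nonempty (X ≅ S) := by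
  have hT := isTriangulating_stdCluster (K := K)
  obtain ⟨S, hS, hSc⟩ := hT.tri.maximal _ _ (chord_ends_ne (pnt_lt X)) (by
    rintro w z ⟨S, hS, hSc⟩ hc
    exact h S hS (Crosses.symm (pnt_crosses_iff.mpr ⟨w, z, hSc, hc⟩)))
  exact ⟨S, hS, iso_iff_chord.mpr hSc.symm⟩

/-! ### Morphisms modulo the standard cluster -/

theorem toCT_map_eq_zero_iff {X Y : C K} (f : X ⟶ Y) :
    (toCT K).map f = 0 ↔ f ∈ factorIdeal (addT K) X Y := by
  rw [← (toCT K).map_zero X Y, Quotient.functor_map_eq_iff]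
  change f - 0 ∈ _ ↔ _
  rw [sub_zero]

theorem addT_embedding {S : Ind K} (hS : S ∈ stdCluster K) :
    addT K ((Mat_.embedding (Ind K)).obj S) :=
  ⟨_, fun _ => hS, ⟨Iso.refl _⟩⟩

/-- Expanding a factorization through a finite direct sum into matrix entries writes it as a sum of
composites through single cluster objects; if all of these vanished, so would f. -/
theorem exists_factor_of_mem {A B : Ind K} {f : A ⟶ B} (hf : f ≠ 0)
    (h : (Mat_.embedding (Ind K)).map f ∈ factorIdeal (addT K) _ _) :
    ∃ S ∈ stdCluster K, ∃ (a : A ⟶ S) (b : S ⟶ B), a ≫ b ≠ 0 := by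
  by_contra hn
  push Not at hn
  have key : ∀ g : (Mat_.embedding (Ind K)).obj A ⟶ (Mat_.embedding (Ind K)).obj B,
      g ∈ factorIdeal (addT K) _ _ → g = 0 := by
    intro g hg
    induction hg using AddSubgroup.closure_induction with
    | mem g hg =>
      obtain ⟨Z, ⟨Y, hY, ⟨e⟩⟩, a, b, rfl⟩ := hg
      have : a ≫ b = (a ≫ e.hom) ≫ (e.inv ≫ b) := by simp
      rw [this]
      apply Mat_.hom_ext
      intro i j
      rw [Mat_.comp_apply]
      exact Finset.sum_eq_zero fun k _ => hn _ (hY k) _ _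
    | zero => rfl
    | add f g _ _ hf hg => rw [hf, hg, add_zero]
    | neg f _ hf => rw [hf, neg_zero]
  exact hf ((Mat_.embedding (Ind K)).map_injective ((key _ h).trans (Functor.map_zero _ _ _).symm))

/-- A nonzero morphism between indecomposable objects vanishes modulo the standard cluster iff
a point of the standard cluster lies in the corresponding rectangle. -/
theorem toCT_map_homog_eq_zero_iff {A B : Ind K} {n : ℤ}
    (h : NonzeroHom (pnt A) ((rot ^ n) (pnt B))) {c : K} (hc : c ≠ 0) :
    (toCT K).map ((Mat_.embedding (Ind K)).map (homog A B n h.1 c)) = 0 ↔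
      ∃ S ∈ stdCluster K, ∃ k : ℤ, pnt A ≤ (rot ^ k) (pnt S) ∧
        (rot ^ k) (pnt S) ≤ (rot ^ n) (pnt B) := by
  rw [toCT_map_eq_zero_iff]
  constructor
  · intro hf
    obtain ⟨S, hS, a, b, hab⟩ := exists_factor_of_mem (homog_ne_zero h hc) hf
    have ha : a ≠ 0 := fun h => hab (by rw [h, Limits.zero_comp])
    have hb : b ≠ 0 := fun h => hab (by rw [h, Limits.comp_zero])
    obtain ⟨k, h1, c', -, rfl⟩ := hom_cases a ha
    obtain ⟨l, h2, d', -, rfl⟩ := hom_cases b hb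
    have h3 := (rot ^ k).monotone h2.1
    rw [← rot_zpow_add] at h3
    rw [homog_comp _ _ (h1.1.trans h3)] at hab
    -- Only the nonvanishing of the composite is known; uniqueness of the degree identifies its
    -- target rectangle.
    obtain rfl := (nonzeroHom_of_homog_ne_zero hab).unique (pnt_lt B) h
    exact ⟨S, hS, k, h1.1, h3⟩
  · rintro ⟨S, hS, k, h1, h2⟩
    refine AddSubgroup.subset_closure ⟨_, addT_embedding hS,
      (Mat_.embedding (Ind K)).map (homog A S k h1 c),
      (Mat_.embedding (Ind K)).map (homog S B (n - k) ?_ 1), ?_⟩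
    · have h3 := (rot ^ (-k)).monotone h2
      rw [← rot_zpow_add, ← rot_zpow_add] at h3
      simpa [sub_eq_add_neg] using h3
    · rw [← Functor.map_comp, homog_comp _ _ (by simpa using h.1), mul_one]
      congr 1
      exact homog_congr (by ring) _ _ _

theorem orbitFunctor_map_basic {X Y : D2 K} (h : X.1.pt ≤ Y.1.pt) :
    (orbitFunctor (D2 K)).map (basic h) =
      homog (OrbitCat.mk X) (OrbitCat.mk Y) 0 (h.trans (le_rot_zpow_zero _)) 1 := by
  unfold homog
  rw [one_smul]
  change DirectSum.of (fun n => ShiftedHom X Y n) 0 (ShiftedHom.mk₀ 0 rfl (basic h)) = _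
  congr 1
  unfold ShiftedHom.mk₀ shiftFunctorZero'
  simp only [eqToIso_refl, Iso.refl_trans]
  have e : (shiftFunctorZero (D2 K) ℤ).inv.app Y =
      basic (X := Y) (Y := rotObj 0 Y) (rotObj_zero Y).ge := rfl
  rw [e]
  exact basic_comp (Z := rotObj 0 Y) _ _

theorem pnt_perturb (S : Ind K) (ε : Set.Ioi (0 : ℝ)) :
    pnt ((perturb S).obj ε) = ⟨(pnt S).x + ε, (pnt S).y + ε⟩ := rfl

theorem perturb_map_comp_homog {S X : Ind K} {ε ε' : Set.Ioi (0 : ℝ)} (hε : ε' ≤ ε) {n : ℤ}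
    (h : pnt ((perturb S).obj ε) ≤ (rot ^ n) (pnt X))
    (h' : pnt ((perturb S).obj ε') ≤ (rot ^ n) (pnt X)) (c : K) :
    (perturb S).map (homOfLE hε) ≫ homog _ X n h c = homog _ X n h' c := by
  have e : (perturb S).map (homOfLE hε) = homog _ _ 0
      (le_trans (⟨add_le_add le_rfl hε, add_le_add le_rfl hε⟩ : pnt ((perturb S).obj ε') ≤
        pnt ((perturb S).obj ε)) (le_rot_zpow_zero _)) 1 := orbitFunctor_map_basic _
  rw [e, homog_comp _ _ (by simpa using h'), one_mul]
  exact homog_congr (add_zero n) _ _ _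

/-! ### The direct limit -/

/-- An element of a directed colimit is zero iff it becomes zero at some stage. -/
theorem nontrivial_tauInvHom_iff {S : Ind K} {Z : CT K} : Nontrivial (tauInvHom S Z) ↔
    ∃ (ε : Set.Ioi (0 : ℝ)) (f : (perturbCT S).obj ε ⟶ Z),
      ∀ (ε' : Set.Ioi (0 : ℝ)) (h : ε' ≤ ε), (perturbCT S).map (homOfLE h) ≫ f ≠ 0 := by
  have : Nonempty (Set.Ioi (0 : ℝ))ᵒᵈ := ⟨OrderDual.toDual ⟨1, Set.mem_Ioi.mpr one_pos⟩⟩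
  have : DirectedSystem
      (fun ε : (Set.Ioi (0 : ℝ))ᵒᵈ => (perturbCT S).obj (OrderDual.ofDual ε) ⟶ Z)
      (fun _ _ h => Preadditive.leftComp Z
        ((perturbCT S).map (homOfLE (OrderDual.ofDual_le_ofDual.mpr h)))) :=
    { map_self := fun i x => by
        change (perturbCT S).map (𝟙 _) ≫ x = x
        rw [CategoryTheory.Functor.map_id, Category.id_comp]
      map_map := fun k j i hij hjk x => by
        change (perturbCT S).map _ ≫ (perturbCT S).map _ ≫ x = (perturbCT S).map _ ≫ x
        rw [← Category.assoc, ← Functor.map_comp, homOfLE_comp] }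
  constructor
  · intro hnt
    obtain ⟨z, hz⟩ := exists_ne (0 : tauInvHom S Z)
    induction z using AddCommGroup.DirectLimit.induction_on with
    | ih i x =>
      refine ⟨OrderDual.ofDual i, x, fun ε' h h0 => hz ?_⟩
      have h1 : i ≤ OrderDual.toDual ε' := h
      refine (AddCommGroup.DirectLimit.of_f
        (G := fun ε : (Set.Ioi (0 : ℝ))ᵒᵈ => (perturbCT S).obj (OrderDual.ofDual ε) ⟶ Z)
        h1 x).symm.trans ?_
      refine (congrArg _ ?_).trans (map_zero _)
      exact h0
  · rintro ⟨ε, f, hf⟩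
    refine nontrivial_of_ne (AddCommGroup.DirectLimit.of
      (fun ε : (Set.Ioi (0 : ℝ))ᵒᵈ => (perturbCT S).obj (OrderDual.ofDual ε) ⟶ Z) _
      (OrderDual.toDual ε) f) 0 fun h0 => ?_
    obtain ⟨j, hj, h1⟩ := AddCommGroup.DirectLimit.of.zero_exact _ _ h0
    exact hf (OrderDual.ofDual j) hj h1

/-- Serves both for isomorphism invariance and for direct summands. -/
theorem nontrivial_tauInvHom_of_retract {S : Ind K} {Z W : CT K} (f : Z ⟶ W) (g : W ⟶ Z)
    (hfg : f ≫ g = 𝟙 Z) (h : Nontrivial (tauInvHom S Z)) : Nontrivial (tauInvHom S W) := by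
  rw [nontrivial_tauInvHom_iff] at h ⊢
  obtain ⟨ε, φ, hφ⟩ := h
  refine ⟨ε, φ ≫ f, fun ε' h h0 => hφ ε' h ?_⟩
  have h1 : ((perturbCT S).map (homOfLE h) ≫ φ ≫ f) ≫ g = 0 := by
    rw [h0, Limits.zero_comp]
  simpa [Category.assoc, hfg] using h1

theorem nontrivial_tauInvHom_sum_iff {S : Ind K} {X : C K} :
    Nontrivial (tauInvHom S ((toCT K).obj X)) ↔
      ∃ i, Nontrivial (tauInvHom S ((toCT K).obj ((Mat_.embedding (Ind K)).obj (X.X i)))) := by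
  classical
  let e := Mat_.isoBiproductEmbedding X
  let b := fun i => (Mat_.embedding (Ind K)).obj (X.X i)
  have htot : ∑ i, (e.hom ≫ Limits.biproduct.π b i) ≫ (Limits.biproduct.ι b i ≫ e.inv) =
      𝟙 X := by
    have h1 : ∀ i, (e.hom ≫ Limits.biproduct.π b i) ≫ (Limits.biproduct.ι b i ≫ e.inv) =
        e.hom ≫ (Limits.biproduct.π b i ≫ Limits.biproduct.ι b i) ≫ e.inv := fun i => by simp
    simp_rw [h1]
    rw [← Preadditive.comp_sum, ← Preadditive.sum_comp, Limits.biproduct.total]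
    exact (congrArg (e.hom ≫ ·) (Category.id_comp _)).trans e.hom_inv_id
  constructor
  · intro h
    by_contra hn
    push Not at hn
    rw [nontrivial_tauInvHom_iff] at h
    obtain ⟨ε, φ, hφ⟩ := h
    have hz : ∀ i, ∃ (ε' : Set.Ioi (0 : ℝ)) (h : ε' ≤ ε), (perturbCT S).map (homOfLE h) ≫
        φ ≫ (toCT K).map (e.hom ≫ Limits.biproduct.π b i) = 0 := by
      intro i
      by_contra hz
      push Not at hz
      exact not_nontrivial_iff_subsingleton.mpr (hn i)
        (nontrivial_tauInvHom_iff.mpr ⟨ε, _, hz⟩)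
    choose δ hδ hδ0 using hz
    -- There are finitely many components, so a single ε kills all of them.
    obtain ⟨ε₁, h₁⟩ := Finite.exists_ge δ
    set ε₂ := min ε₁ ε with hε₂
    refine hφ ε₂ (min_le_right _ _) ?_
    have hid : 𝟙 ((toCT K).obj X) = ∑ i, (toCT K).map (e.hom ≫ Limits.biproduct.π b i) ≫
        (toCT K).map (Limits.biproduct.ι b i ≫ e.inv) := by
      simp_rw [← Functor.map_comp]
      rw [← Functor.map_sum, htot, CategoryTheory.Functor.map_id]
    rw [← Category.comp_id φ, hid, Preadditive.comp_sum, Preadditive.comp_sum]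
    refine Finset.sum_eq_zero fun i _ => ?_
    have h2 : (perturbCT S).map (homOfLE (min_le_right ε₁ ε)) =
        (perturbCT S).map (homOfLE ((min_le_left ε₁ ε).trans (h₁ i))) ≫
          (perturbCT S).map (homOfLE (hδ i)) := by
      rw [← Functor.map_comp, homOfLE_comp]
    rw [h2]
    have h3 := congrArg (fun x => (perturbCT S).map
      (homOfLE ((min_le_left ε₁ ε).trans (h₁ i))) ≫ x ≫
        (toCT K).map (Limits.biproduct.ι b i ≫ e.inv)) (hδ0 i)
    simpa only [Category.assoc, Limits.zero_comp, Limits.comp_zero] using h3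
  · rintro ⟨i, h⟩
    refine nontrivial_tauInvHom_of_retract
      ((toCT K).map (Limits.biproduct.ι b i ≫ e.inv))
      ((toCT K).map (e.hom ≫ Limits.biproduct.π b i)) ?_ h
    rw [← Functor.map_comp, ← CategoryTheory.Functor.map_id]
    congr 1
    simp [b]

/-! ### The support of an indecomposable object -/

theorem stdCluster_not_crosses {S S' : Ind K} (hS : S ∈ stdCluster K) (hS' : S' ∈ stdCluster K) :
    ¬ Crosses (pnt S) (pnt S') := by
  intro hc
  obtain ⟨w, z, h1, h2⟩ := pnt_crosses_iff.mp hc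
  exact isTriangulating_stdCluster.tri.noncrossing _ _ _ _ ⟨S, hS, rfl⟩ ⟨S', hS', h1⟩ h2

theorem exists_rot_of_stdRel {p : Pt} (hp : |p.y - p.x| < Real.pi)
    (h : StdRel (vmod p.x) (vmod (p.y + Real.pi))) :
    ∃ S ∈ stdCluster K, ∃ k : ℤ, (rot ^ k) (pnt S) = p := by
  rw [← chordRel_stdCluster (K := K)] at h
  obtain ⟨S, hS, hSc⟩ := h
  obtain ⟨k, hk⟩ := (chord_eq_iff hp (pnt_lt S)).mp hSc.symm
  exact ⟨S, hS, k, hk.symm⟩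

theorem exists_pi_div_two_pow_le {δ : ℝ} (h : 0 < δ) : ∃ d : ℕ, Real.pi / 2 ^ d ≤ δ := by
  obtain ⟨d, hd⟩ := pow_unbounded_of_one_lt (Real.pi / δ) one_lt_two
  refine ⟨d, ?_⟩
  rw [div_lt_iff₀ h, mul_comm, ← div_lt_iff₀ (by positivity)] at hd
  exact hd.le

/-- The short dyadic chords starting at the end of a dyadic chord. -/
theorem exists_std_fan {S : Ind K} (hS : S ∈ stdCluster K) {δ : ℝ} (hδ : 0 < δ) :
    ∃ η, 0 < η ∧ η ≤ δ ∧
      (∃ S' ∈ stdCluster K, ∃ k : ℤ,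
        (rot ^ k) (pnt S') = ⟨(pnt S).y + Real.pi, (pnt S).y + η⟩) ∧
      (∃ S' ∈ stdCluster K, ∃ k : ℤ,
        (rot ^ k) (pnt S') = ⟨(pnt S).x + η, (pnt S).x + Real.pi⟩) := by
  obtain ⟨n, m, -, -, rfl⟩ := hS
  obtain ⟨d, hd⟩ := exists_pi_div_two_pow_le hδ
  have hpi := Real.pi_pos
  have h1 := pi_div_two_pow_le (n + d)
  have h2 : 0 < Real.pi / 2 ^ (n + d) := by positivity
  have h3 : Real.pi / 2 ^ (n + d) ≤ Real.pi / 2 ^ d := by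
    apply div_le_div_of_nonneg_left hpi.le (by positivity)
    exact pow_le_pow_right₀ one_le_two (by omega)
  have hx : (pnt (M K (stdPt n m))).x = dyad (n + d) (m * 2 ^ d) := by
    rw [dyad_mul_two_pow]
    simp [pnt, M, orbitFunctor, stdPt, dyad]
  have hy : (pnt (M K (stdPt n m))).y + Real.pi =
      dyad (n + d) ((m - 1 + 2 ^ (n + 1)) * 2 ^ d) := by
    rw [dyad_mul_two_pow]
    have := dyad_add_mul n (m - 1) 1
    rw [one_mul] at this
    rw [this]
    simp only [pnt, M, orbitFunctor, stdPt, dyad]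
    push_cast
    ring
  -- Level n + d refines level n, so a step of this length from an end of S is a dyadic chord.
  refine ⟨Real.pi / 2 ^ (n + d), h2, h3.trans hd, exists_rot_of_stdRel ?_ ?_,
    exists_rot_of_stdRel ?_ ?_⟩
  · rw [abs_lt]
    constructor <;> dsimp only <;> linarith
  · dsimp only
    rw [add_right_comm, hy, ← dyad_add_one]
    exact stdRel_dyad _ _
  · rw [abs_lt]
    constructor <;> dsimp only <;> linarith
  · dsimp only
    have := vmod_add_mul (dyad (n + d) (m * 2 ^ d)) 1
    rw [Int.cast_one, one_mul] at this
    rw [hx, ← dyad_add_one, add_assoc, ← two_mul, this]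
    exact (stdRel_dyad _ _).symm

theorem perturbCT_map_comp {S X : Ind K} {ε ε' : Set.Ioi (0 : ℝ)} (hε : ε' ≤ ε) {n : ℤ}
    (h : pnt ((perturb S).obj ε) ≤ (rot ^ n) (pnt X))
    (h' : pnt ((perturb S).obj ε') ≤ (rot ^ n) (pnt X)) (c : K) :
    (perturbCT S).map (homOfLE hε) ≫
      (toCT K).map ((Mat_.embedding (Ind K)).map (homog _ X n h c)) =
      (toCT K).map ((Mat_.embedding (Ind K)).map (homog _ X n h' c)) := by
  rw [← perturb_map_comp_homog hε h h' c, Functor.map_comp, Functor.map_comp]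
  rfl

/-- For small ε the basic morphism from S_ε is nonzero in the orbit category. A cluster point in its
rectangle would be strictly above and to the right of S, within the bounds of a crossing, and would
cross S. -/
theorem nontrivial_of_crosses {S X : Ind K} (hS : S ∈ stdCluster K)
    (h : Crosses (pnt S) (pnt X)) :
    Nontrivial (tauInvHom S ((toCT K).obj ((Mat_.embedding (Ind K)).obj X))) := by
  obtain ⟨n, h1, h2, h3, h4⟩ := h
  rw [nontrivial_tauInvHom_iff]
  have hpos : 0 < min (((rot ^ n) (pnt X)).x - (pnt S).x) (((rot ^ n) (pnt X)).y - (pnt S).y) :=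
    lt_min (by linarith) (by linarith)
  have hnz : ∀ ε : Set.Ioi (0 : ℝ), (ε : ℝ) ≤
      min (((rot ^ n) (pnt X)).x - (pnt S).x) (((rot ^ n) (pnt X)).y - (pnt S).y) →
      NonzeroHom (pnt ((perturb S).obj ε)) ((rot ^ n) (pnt X)) := by
    intro ε hε
    have h5 : (0 : ℝ) < ε := ε.2
    have h6 := hε.trans (min_le_left _ _)
    have h7 := hε.trans (min_le_right _ _)
    rw [pnt_perturb]
    refine ⟨⟨?_, ?_⟩, ?_, ?_⟩ <;> dsimp only <;> linarith
  refine ⟨⟨_, hpos⟩, (toCT K).map ((Mat_.embedding (Ind K)).map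
    (homog _ X n (hnz ⟨_, hpos⟩ le_rfl).1 1)), fun ε' hε' => ?_⟩
  rw [perturbCT_map_comp hε' _ (hnz ε' hε').1]
  refine mt (toCT_map_homog_eq_zero_iff (hnz ε' hε') one_ne_zero).mp ?_
  rintro ⟨S', hS', k, h5, h6⟩
  rw [pnt_perturb] at h5
  obtain ⟨h5, h7⟩ := h5
  obtain ⟨h6, h8⟩ := h6
  dsimp only at h5 h7
  have h9 : (0 : ℝ) < ε' := ε'.2
  refine stdCluster_not_crosses hS hS' ⟨k, ?_, ?_, ?_, ?_⟩ <;> linarith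

/-- A morphism surviving for all small ε gives the upper bounds of a crossing weakly, as ε tends to
0. Equality is excluded because a short dyadic chord at an end of S would lie in the rectangle and
kill the morphism. -/
theorem crosses_of_nontrivial {S X : Ind K} (hS : S ∈ stdCluster K)
    (h : Nontrivial (tauInvHom S ((toCT K).obj ((Mat_.embedding (Ind K)).obj X)))) :
    Crosses (pnt S) (pnt X) := by
  rw [nontrivial_tauInvHom_iff] at h
  obtain ⟨ε, φ, hφ⟩ := h
  obtain ⟨f', rfl⟩ := (toCT K).map_surjective φ
  obtain ⟨f, rfl⟩ := (Mat_.embedding (Ind K)).map_surjective f'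
  have hf : f ≠ 0 := by
    rintro rfl
    refine hφ ε le_rfl ?_
    rw [Functor.map_zero, Functor.map_zero]
    exact Limits.comp_zero
  obtain ⟨n, hn, c, hc, rfl⟩ := hom_cases f hf
  have hle : ∀ ε' : Set.Ioi (0 : ℝ), ε' ≤ ε →
      pnt ((perturb S).obj ε') ≤ (rot ^ n) (pnt X) := fun ε' h =>
    le_trans (⟨add_le_add le_rfl h, add_le_add le_rfl h⟩ : pnt ((perturb S).obj ε') ≤
      pnt ((perturb S).obj ε)) hn.1
  have hne : ∀ (ε' : Set.Ioi (0 : ℝ)) (h : ε' ≤ ε),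
      (toCT K).map ((Mat_.embedding (Ind K)).map (homog _ X n (hle ε' h) c)) ≠ 0 := by
    intro ε' h
    rw [← perturbCT_map_comp h hn.1 (hle ε' h) c]
    exact hφ ε' h
  have hnz : ∀ ε' : Set.Ioi (0 : ℝ), ε' ≤ ε →
      NonzeroHom (pnt ((perturb S).obj ε')) ((rot ^ n) (pnt X)) := by
    intro ε' h
    refine nonzeroHom_of_homog_ne_zero (h := hle ε' h) (c := c) fun h0 => hne ε' h ?_
    rw [h0, Functor.map_zero, Functor.map_zero]
  have hrect : ∀ (ε' : Set.Ioi (0 : ℝ)), ε' ≤ ε → ∀ S' ∈ stdCluster K, ∀ k : ℤ,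
      pnt ((perturb S).obj ε') ≤ (rot ^ k) (pnt S') →
      ¬ (rot ^ k) (pnt S') ≤ (rot ^ n) (pnt X) := fun ε' h S' hS' k h1 h2 =>
    hne ε' h ((toCT_map_homog_eq_zero_iff (hnz ε' h) hc).mpr ⟨S', hS', k, h1, h2⟩)
  have hε0 : (0 : ℝ) < ε := ε.2
  have hs := abs_lt.mp (pnt_lt S)
  have hx1 : (pnt S).x + ε ≤ ((rot ^ n) (pnt X)).x := hn.1.1
  have hy1 : (pnt S).y + ε ≤ ((rot ^ n) (pnt X)).y := hn.1.2
  have hx2 : ((rot ^ n) (pnt X)).x ≤ (pnt S).y + Real.pi := by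
    refine le_of_forall_pos_lt_add fun δ hδ => ?_
    have h1 := (hnz ⟨min (ε : ℝ) δ, lt_min hε0 hδ⟩ (min_le_left (ε : ℝ) δ)).2.1
    have h2 : ((rot ^ n) (pnt X)).x < (pnt S).y + min (ε : ℝ) δ + Real.pi := h1
    have := min_le_right (ε : ℝ) δ
    linarith
  have hy2 : ((rot ^ n) (pnt X)).y ≤ (pnt S).x + Real.pi := by
    refine le_of_forall_pos_lt_add fun δ hδ => ?_
    have h1 := (hnz ⟨min (ε : ℝ) δ, lt_min hε0 hδ⟩ (min_le_left (ε : ℝ) δ)).2.2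
    have h2 : ((rot ^ n) (pnt X)).y < (pnt S).x + min (ε : ℝ) δ + Real.pi := h1
    have := min_le_right (ε : ℝ) δ
    linarith
  obtain ⟨η, hη, hηε, hfan1, hfan2⟩ := exists_std_fan hS hε0
  refine ⟨n, by linarith, lt_of_le_of_ne hx2 fun heq => ?_, by linarith,
    lt_of_le_of_ne hy2 fun heq => ?_⟩
  · obtain ⟨S', hS', k, hk⟩ := hfan1
    -- The bound η controls the second coordinate of S_ε' and the other term its first, so S_ε' lies
    -- below the fan point.
    have hpos : 0 < min η ((pnt S).y + Real.pi - (pnt S).x) := lt_min hη (by linarith)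
    have m1 := min_le_left η ((pnt S).y + Real.pi - (pnt S).x)
    have m2 := min_le_right η ((pnt S).y + Real.pi - (pnt S).x)
    refine hrect ⟨_, hpos⟩ (m1.trans hηε) S' hS' k ?_ ?_
    · rw [hk, pnt_perturb]
      constructor <;> dsimp only <;> linarith
    · rw [hk]
      constructor <;> dsimp only <;> linarith
  · obtain ⟨S', hS', k, hk⟩ := hfan2
    have hpos : 0 < min η ((pnt S).x + Real.pi - (pnt S).y) := lt_min hη (by linarith)
    have m1 := min_le_left η ((pnt S).x + Real.pi - (pnt S).y)
    have m2 := min_le_right η ((pnt S).x + Real.pi - (pnt S).y)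
    refine hrect ⟨_, hpos⟩ (m1.trans hηε) S' hS' k ?_ ?_
    · rw [hk, pnt_perturb]
      constructor <;> dsimp only <;> linarith
    · rw [hk]
      constructor <;> dsimp only <;> linarith

/-- For an indecomposable object `X`, `Hom(τ⁻¹S, X) ≠ 0` in `C/T` iff the chords of `S` and `X`
cross. -/
theorem nontrivial_tauInvHom_iff_crosses {S X : Ind K} (hS : S ∈ stdCluster K) :
    Nontrivial (tauInvHom S ((toCT K).obj ((Mat_.embedding (Ind K)).obj X))) ↔
      Crosses (pnt S) (pnt X) :=
  ⟨crosses_of_nontrivial hS, nontrivial_of_crosses hS⟩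

/-- The clause excluding S ≅ X is automatic, since equal chords do not cross. -/
theorem mem_support_iff {X : C K} {S : Ind K} :
    S ∈ support X ↔ S ∈ stdCluster K ∧ ∃ i, Crosses (pnt S) (pnt (X.X i)) := by
  refine and_congr_right fun hS => exists_congr fun i => ?_
  rw [nontrivial_tauInvHom_iff_crosses hS, and_iff_right_iff_imp]
  exact fun hc => ⟨fun e => not_crosses_of_chord_eq (iso_iff_chord.mp ⟨e⟩) hc⟩

theorem supportCT_toCT (X : C K) : supportCT ((toCT K).obj X) = support X := by
  ext S
  rw [mem_support_iff]
  refine and_congr_right fun hS => ?_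
  rw [nontrivial_tauInvHom_sum_iff]
  exact exists_congr fun i => nontrivial_tauInvHom_iff_crosses hS

theorem supportCT_congr {Z W : CT K} (e : Z ≅ W) : supportCT Z = supportCT W := by
  ext S
  exact and_congr_right fun _ =>
    ⟨nontrivial_tauInvHom_of_retract e.hom e.inv e.hom_inv_id,
      nontrivial_tauInvHom_of_retract e.inv e.hom e.inv_hom_id⟩

/-! ### Supports and the subcategories `add T` and `X` -/

theorem addClosure_of_components {U : Set (Ind K)} {X : C K}
    (h : ∀ i, ∃ Y ∈ U, Nonempty (X.X i ≅ Y)) : addClosure K U X := by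
  choose Y hY e using h
  refine ⟨⟨X.ι, Y⟩, hY, ⟨?_⟩⟩
  exact Mat_.isoBiproductEmbedding X ≪≫
    Limits.biproduct.mapIso (fun i => (Mat_.embedding (Ind K)).mapIso (e i).some) ≪≫
    (Mat_.isoBiproductEmbedding (⟨X.ι, Y⟩ : C K)).symm

theorem support_congr {X Y : C K} (e : X ≅ Y) : support X = support Y := by
  rw [← supportCT_toCT, ← supportCT_toCT]
  exact supportCT_congr ((toCT K).mapIso e)

theorem support_eq_iUnion (X : C K) :
    support X = ⋃ i, {S ∈ stdCluster K | Crosses (pnt S) (pnt (X.X i))} := by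
  ext S
  simp [mem_support_iff]

/-- Standard chords do not cross each other, and a chord crossing none of them is standard by
maximality. -/
theorem addT_iff (X : C K) : addT K X ↔ support X = ∅ := by
  constructor
  · rintro ⟨Y, hY, ⟨e⟩⟩
    rw [support_congr e, Set.eq_empty_iff_forall_notMem]
    intro S hS
    obtain ⟨hS, i, hc⟩ := mem_support_iff.mp hS
    exact stdCluster_not_crosses hS (hY i) hc
  · intro h
    refine addClosure_of_components fun i => exists_iso_of_not_crosses fun S hS hc => ?_
    exact (Set.eq_empty_iff_forall_notMem.mp h S) (mem_support_iff.mpr ⟨hS, i, hc⟩)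

theorem support_finite_iff (X : C K) : (support X).Finite ↔ rationalSub K X := by
  constructor
  · intro h
    refine addClosure_of_components fun i => ⟨X.X i, isRational_iff.mpr (h.subset ?_),
      ⟨Iso.refl _⟩⟩
    rintro S ⟨hS, hc⟩
    exact mem_support_iff.mpr ⟨hS, i, hc⟩
  · rintro ⟨Y, hY, ⟨e⟩⟩
    rw [support_congr e, support_eq_iUnion]
    exact Set.finite_iUnion fun i => isRational_iff.mp (hY i)

theorem isZero_toCT_of_addT {X : C K} (h : addT K X) : Limits.IsZero ((toCT K).obj X) := by
  rw [Limits.IsZero.iff_id_eq_zero, ← CategoryTheory.Functor.map_id, toCT_map_eq_zero_iff]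
  exact AddSubgroup.subset_closure ⟨X, h, 𝟙 X, 𝟙 X, by simp⟩

theorem isZero_iff (Z : CT K) : Limits.IsZero Z ↔ supportCT Z = ∅ := by
  constructor
  · intro hZ
    rw [Set.eq_empty_iff_forall_notMem]
    rintro S ⟨-, hS⟩
    obtain ⟨ε, f, hf⟩ := nontrivial_tauInvHom_iff.mp hS
    exact hf ε le_rfl (hZ.eq_of_tgt _ _)
  · intro h
    -- Every object of the quotient is the image of an object of the cluster category.
    have h1 : supportCT ((toCT K).obj Z.as) = ∅ := h
    rw [supportCT_toCT, ← addT_iff] at h1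
    exact isZero_toCT_of_addT h1

theorem rationalSubCT_iff (Z : CT K) : rationalSubCT K Z ↔ (supportCT Z).Finite := by
  constructor
  · rintro ⟨X, hX, ⟨e⟩⟩
    rw [← supportCT_congr e, supportCT_toCT, support_finite_iff]
    exact hX
  · intro h
    have h1 : (supportCT ((toCT K).obj Z.as)).Finite := h
    rw [supportCT_toCT, support_finite_iff] at h1
    exact ⟨Z.as, h1, ⟨Iso.refl _⟩⟩

end ContinuousCluster

end

theorem mainTheorem8 (K : Type*) [Field K] :
    (∀ X : ContinuousCluster.C K,
      ContinuousCluster.addT K X ↔ ContinuousCluster.support X = ∅) ∧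
    (∀ X : ContinuousCluster.C K,
      (ContinuousCluster.support X).Finite ↔ ContinuousCluster.rationalSub K X) ∧
    (∀ X : ContinuousCluster.C K,
      ContinuousCluster.supportCT ((ContinuousCluster.toCT K).obj X) =
        ContinuousCluster.support X) ∧
    (∀ Z W : ContinuousCluster.CT K, Nonempty (Z ≅ W) →
      ContinuousCluster.supportCT Z = ContinuousCluster.supportCT W) ∧
    (∀ Z : ContinuousCluster.CT K,
      Limits.IsZero Z ↔ ContinuousCluster.supportCT Z = ∅) ∧
    (∀ Z : ContinuousCluster.CT K,
      ContinuousCluster.rationalSubCT K Z ↔ (ContinuousCluster.supportCT Z).Finite) := by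
  exact ⟨ContinuousCluster.addT_iff, ContinuousCluster.support_finite_iff,
    ContinuousCluster.supportCT_toCT, fun _ _ ⟨e⟩ => ContinuousCluster.supportCT_congr e,
    ContinuousCluster.isZero_iff, ContinuousCluster.rationalSubCT_iff⟩
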